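/- Let $\mu^{(k)}$, $k\in\mathbb N_0$, be finite non-negative Borel measures on $\mathbb R$, each with bounded and infinite support. Let $p_l^{(k)}$ be the orthonormal polynomials of $\mu^{(k)}$ ($\deg p_l^{(k)}=l$, positive leading coefficient), with three-term recurrence $$x\,p_l^{(k)}(x)=b_{l+1}^{(k)}p_{l+1}^{(k)}(x)+a_l^{(k)}p_l^{(k)}(x)+b_l^{(k)}p_{l-1}^{(k)}(x),\qquad l\in\mathbb N_0,\quad p_{-1}^{(k)}=0,\ b_0^{(k)}=0,$$ and let $x_{l,1}^{(k)}<\dots<x_{l,l}^{(k)}$ be the zeros of $p_l^{(k)}$. Suppose that the family belongs to the mean Nevai class $M^{(C,1)}(\Sigma_{l_a,l_b})$ of the arithmetic mean, that is, 1. $\sup_{n,k}|a_n^{(k)}|<\infty$ and $\sup_{n,k}|b_n^{(k)}|<\infty$; 2. $\displaystyle\lim_{n\to\infty}\frac1{n+1}\sum_{k=0}^n|a_{k+l}^{(n-k)}-a_k^{(n-k)}|=0$ and $\displaystyle\lim_{n\to\infty}\frac1{n+1}\sum_{k=0}^n|b_{k+l}^{(n-k)}-b_k^{(n-k)}|=0$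 for all $l\in\mathbb N$; 3. $\displaystyle\lim_{n\to\infty}\frac1{n+1}\sum_{k=0}^n(a_k^{(n-k)})^{l_a}(b_k^{(n-k)})^{l_b}=\Sigma_{l_a,l_b}$ for all $l_a,l_b\in\mathbb N_0$ (with $0^0=1$), with the values $$\Sigma_{l_a,l_b}=\delta_{0,l_a}\,\frac{\Gamma(\frac32)}{2^{l_b}}\,\frac{\Gamma(\frac{l_b+2}{2})}{\Gamma(\frac{l_b+3}{2})}.$$ Then the equilibrium measure of the family, i.e. the weak limit of the probability measures $$\bar\mu_n=\sum_{k=0}^n\frac1{n+1}\,\bigl(p_k^{(n-k)}\bigr)^2\,d\mu^{(n-k)},$$ exists and is the uniform probability measure $\frac12\chi_{[-1,1]}(x)\,dx$ on $[-1,1]$. The mean zero distributions $$\nu_{n+1}=\frac{2}{(n+1)(n+2)}\sum_{k=0}^n\sum_{j=1}^{k+1}\delta_{x_{k+1,j}^{(n-k)}}$$ are probability measures and converge weakly to the same measure. Moreover, for every continuous $f:\mathbb R\to\mathbb R$, $$\lim_{n\to\infty}\sum_{k=0}^n\frac1{n+1}\int_{\mathbb R}f(x)\,|p_k^{(n-k)}(x)|^2\,d\mu^{(n-k)}(x)=\lim_{n\to\infty}\sum_{k=0}^n\sum_{j=1}^{k+1}\frac{2f(x_{k+1,j}^{(n-k)})}{(n+1)(n+2)}=\frac12\int_{-1}^1f(x)\,dx,$$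 and if $f$ is only given and continuous on $[-1,1]$, the same limits hold when the integrals on the left are taken over $[-1,1]$ and the sum over the zeros is restricted to the zeros lying in $[-1,1]$. -/

import Mathlib

open MeasureTheory Polynomial Filter Topology
open scoped ENNReal

noncomputable section

namespace MeanNevai

/-! ### Orthonormal polynomials of a measure on the real line -/

/-- The measures under consideration: finite, of bounded support, and with infinitely many points
in the support, so that orthonormal polynomials of every degree exist. -/
structure IsAdmissible (μ : Measure ℝ) : Prop where
  finite : IsFiniteMeasure μ
  bounded_support : Bornology.IsBounded μ.support
  infinite_support : μ.support.Infinite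

/-- The inner product of two real polynomials in `L²(μ)`. -/
def ip (μ : Measure ℝ) (f g : ℝ[X]) : ℝ := ∫ x, f.eval x * g.eval x ∂μ

/-- The orthonormal polynomial of degree `l` with positive leading coefficient, by the
Gram-Schmidt process applied to the monomials. The theorems `natDegree_orthoPoly`,
`leadingCoeff_orthoPoly_pos` and `ip_orthoPoly` below state the defining properties. -/
def orthoPoly (μ : Measure ℝ) (l : ℕ) : ℝ[X] :=
  let q : ℝ[X] := X ^ l - ∑ j : Fin l, C (ip μ (X ^ l) (orthoPoly μ j)) * orthoPoly μ j
  C (Real.sqrt (ip μ q q))⁻¹ * q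
termination_by l
decreasing_by exact j.2

/-- The diagonal recurrence coefficient `a_l`; see `three_term_recurrence`. -/
def recA (μ : Measure ℝ) (l : ℕ) : ℝ := ip μ (X * orthoPoly μ l) (orthoPoly μ l)

/-- The off-diagonal recurrence coefficient `b_l`, with the convention `b_0 = 0`;
see `three_term_recurrence`. -/
def recB (μ : Measure ℝ) : ℕ → ℝ
  | 0 => 0
  | l + 1 => ip μ (X * orthoPoly μ l) (orthoPoly μ (l + 1))

/-! ### The defining properties -/

section Properties

theorem IsAdmissible.integrable {μ : Measure ℝ} (h : IsAdmissible μ) {f : ℝ → ℝ}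
    (hf : Continuous f) : Integrable f μ := by
  have := h.finite
  have hc : IsCompact μ.support :=
    Metric.isCompact_of_isClosed_isBounded Measure.isClosed_support h.bounded_support
  have h1 : IntegrableOn f μ.support μ := hf.continuousOn.integrableOn_compact hc
  rwa [IntegrableOn, Measure.restrict_eq_self_of_ae_mem] at h1
  exact Measure.support_mem_ae

theorem IsAdmissible.integrable_mul {μ : Measure ℝ} (h : IsAdmissible μ) (f g : ℝ[X]) :
    Integrable (fun x => f.eval x * g.eval x) μ :=
  h.integrable (f.continuous.mul g.continuous)

theorem ip_comm (μ : Measure ℝ) (f g : ℝ[X]) : ip μ f g = ip μ g f := by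
  simp only [ip, mul_comm]

theorem ip_C_mul (μ : Measure ℝ) (c : ℝ) (f g : ℝ[X]) : ip μ (C c * f) g = c * ip μ f g := by
  simp only [ip, eval_mul, eval_C, mul_assoc, integral_const_mul]

theorem ip_X_mul (μ : Measure ℝ) (f g : ℝ[X]) : ip μ (X * f) g = ip μ f (X * g) := by
  simp only [ip, eval_mul, eval_X]
  congr 1; ext x; ring

theorem IsAdmissible.ip_add {μ : Measure ℝ} (h : IsAdmissible μ) (f g r : ℝ[X]) :
    ip μ (f + g) r = ip μ f r + ip μ g r := by
  simp only [ip, eval_add, add_mul]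
  exact integral_add (h.integrable_mul f r) (h.integrable_mul g r)

theorem IsAdmissible.ip_sub {μ : Measure ℝ} (h : IsAdmissible μ) (f g r : ℝ[X]) :
    ip μ (f - g) r = ip μ f r - ip μ g r := by
  simp only [ip, eval_sub, sub_mul]
  exact integral_sub (h.integrable_mul f r) (h.integrable_mul g r)

theorem IsAdmissible.ip_sum {μ : Measure ℝ} (h : IsAdmissible μ) {ι : Type*} (s : Finset ι)
    (f : ι → ℝ[X]) (r : ℝ[X]) : ip μ (∑ i ∈ s, f i) r = ∑ i ∈ s, ip μ (f i) r := by
  simp only [ip, eval_finsetSum, Finset.sum_mul]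
  exact integral_finsetSum s fun i _ => h.integrable_mul (f i) r

theorem IsAdmissible.integral_pos {μ : Measure ℝ} (h : IsAdmissible μ) {q : ℝ[X]} (hq : q ≠ 0)
    (h0 : ∀ x, 0 ≤ q.eval x) : 0 < ∫ x, q.eval x ∂μ := by
  rw [integral_pos_iff_support_of_nonneg h0 (h.integrable q.continuous)]
  rw [pos_iff_ne_zero]
  intro hz
  apply h.infinite_support
  have hfin : {x : ℝ | q.IsRoot x}.Finite := Polynomial.finite_setOfPred_isRoot hq
  refine hfin.subset (Measure.support_subset_of_isClosed hfin.isClosed ?_)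
  rw [mem_ae_iff]
  refine measure_mono_null (fun x hx => ?_) hz
  simpa [IsRoot] using hx

theorem IsAdmissible.ip_self_pos {μ : Measure ℝ} (h : IsAdmissible μ) {q : ℝ[X]} (hq : q ≠ 0) :
    0 < ip μ q q := by
  have := h.integral_pos (mul_ne_zero hq hq) (fun x => by
    rw [eval_mul]; exact mul_self_nonneg _)
  simpa [ip] using this

theorem degree_C_mul_le_degree (c : ℝ) (p : ℝ[X]) : (C c * p).degree ≤ p.degree := by
  rw [← smul_eq_C_mul]
  exact degree_smul_le c p

theorem IsAdmissible.orthoPoly_spec {μ : Measure ℝ} (h : IsAdmissible μ) (l : ℕ) :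
    (orthoPoly μ l).natDegree = l ∧ 0 < (orthoPoly μ l).leadingCoeff ∧
      ip μ (orthoPoly μ l) (orthoPoly μ l) = 1 ∧
      ∀ j < l, ip μ (orthoPoly μ l) (orthoPoly μ j) = 0 := by
  induction l using Nat.strong_induction_on with
  | _ l ih =>
    set s : ℝ[X] := ∑ j : Fin l, C (ip μ (X ^ l) (orthoPoly μ j)) * orthoPoly μ j with hs
    have hsdeg : s.degree < (l : WithBot ℕ) := by
      refine (degree_sum_le _ _).trans_lt ?_
      refine (Finset.sup_lt_iff (WithBot.bot_lt_coe l)).2 ?_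
      intro j _
      refine (degree_C_mul_le_degree _ _).trans_lt ?_
      refine degree_le_natDegree.trans_lt ?_
      rw [(ih j j.2).1]
      exact WithBot.coe_lt_coe.2 j.2
    have hmon : (X ^ l - s).Monic := monic_X_pow_sub hsdeg
    have hnd : (X ^ l - s).natDegree = l := by
      refine natDegree_eq_of_degree_eq_some ?_
      rw [degree_sub_eq_left_of_degree_lt, degree_X_pow]
      rwa [degree_X_pow]
    have hpos : 0 < ip μ (X ^ l - s) (X ^ l - s) := h.ip_self_pos hmon.ne_zero
    set c : ℝ := (Real.sqrt (ip μ (X ^ l - s) (X ^ l - s)))⁻¹ with hc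
    have hcpos : 0 < c := inv_pos.2 (Real.sqrt_pos.2 hpos)
    have hp : orthoPoly μ l = C c * (X ^ l - s) := by rw [orthoPoly]
    refine ⟨?_, ?_, ?_, ?_⟩
    · rw [hp, natDegree_C_mul hcpos.ne', hnd]
    · rw [hp, leadingCoeff_mul, leadingCoeff_C, hmon.leadingCoeff, mul_one]
      exact hcpos
    · rw [hp, ip_C_mul, ip_comm, ip_C_mul, hc, ← mul_assoc, ← mul_inv,
        Real.mul_self_sqrt hpos.le, inv_mul_cancel₀ hpos.ne']
    · intro i hi
      rw [hp, ip_C_mul, h.ip_sub, hs, h.ip_sum]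
      simp only [ip_C_mul]
      rw [Finset.sum_eq_single (⟨i, hi⟩ : Fin l)]
      · rw [(ih i hi).2.2.1]; ring
      · intro j _ hji
        have hji' : (j : ℕ) ≠ i := fun e => hji (Fin.ext e)
        rcases lt_or_gt_of_ne hji' with hlt | hlt
        · rw [ip_comm μ (orthoPoly μ j), (ih i hi).2.2.2 j hlt, mul_zero]
        · rw [(ih j j.2).2.2.2 i hlt, mul_zero]
      · intro hn; exact absurd (Finset.mem_univ _) hn

theorem natDegree_orthoPoly {μ : Measure ℝ} (h : IsAdmissible μ) (l : ℕ) :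
    (orthoPoly μ l).natDegree = l := (h.orthoPoly_spec l).1

theorem leadingCoeff_orthoPoly_pos {μ : Measure ℝ} (h : IsAdmissible μ) (l : ℕ) :
    0 < (orthoPoly μ l).leadingCoeff := (h.orthoPoly_spec l).2.1

theorem ip_orthoPoly {μ : Measure ℝ} (h : IsAdmissible μ) (l m : ℕ) :
    ip μ (orthoPoly μ l) (orthoPoly μ m) = if l = m then 1 else 0 := by
  rcases lt_trichotomy l m with hlt | rfl | hlt
  · rw [if_neg hlt.ne, ip_comm, (h.orthoPoly_spec m).2.2.2 l hlt]
  · rw [if_pos rfl, (h.orthoPoly_spec l).2.2.1]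
  · rw [if_neg hlt.ne', (h.orthoPoly_spec l).2.2.2 m hlt]

theorem ip_eq_zero_of_forall_lt {μ : Measure ℝ} (h : IsAdmissible μ) (g : ℝ[X]) (n : ℕ)
    (hg : ∀ j < n, ip μ (orthoPoly μ j) g = 0) (r : ℝ[X]) (hr : r.degree < (n : WithBot ℕ)) :
    ip μ r g = 0 := by
  induction n generalizing r with
  | zero =>
    have : r = 0 := by
      rw [← degree_eq_bot]
      simpa using hr
    simp [this, ip]
  | succ n ih =>
    have hl := leadingCoeff_orthoPoly_pos h n
    set t : ℝ := r.coeff n / (orthoPoly μ n).leadingCoeff with ht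
    have hd : (r - C t * orthoPoly μ n).degree < (n : WithBot ℕ) := by
      rw [degree_lt_iff_coeff_zero]
      intro m hm
      rw [coeff_sub, coeff_C_mul]
      rcases hm.eq_or_lt with rfl | hm
      · have : (orthoPoly μ n).coeff n = (orthoPoly μ n).leadingCoeff := by
          rw [leadingCoeff, natDegree_orthoPoly h]
        rw [this, ht, div_mul_cancel₀ _ hl.ne', sub_self]
      · rw [coeff_eq_zero_of_natDegree_lt (p := orthoPoly μ n) (by rwa [natDegree_orthoPoly h]),
          mul_zero, coeff_eq_zero_of_degree_lt (hr.trans_le (by exact_mod_cast hm)), sub_zero]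
    have h1 := ih (fun j hj => hg j (hj.trans n.lt_succ_self)) _ hd
    rw [h.ip_sub, ip_C_mul, hg n n.lt_succ_self, mul_zero, sub_zero] at h1
    exact h1

theorem ip_orthoPoly_of_degree_lt {μ : Measure ℝ} (h : IsAdmissible μ) (l : ℕ) (r : ℝ[X])
    (hr : r.degree < (l : WithBot ℕ)) : ip μ r (orthoPoly μ l) = 0 :=
  ip_eq_zero_of_forall_lt h _ l (fun j hj => by rw [ip_orthoPoly h, if_neg hj.ne]) r hr

theorem degree_orthoPoly {μ : Measure ℝ} (h : IsAdmissible μ) (l : ℕ) :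
    (orthoPoly μ l).degree = (l : WithBot ℕ) := by
  rw [degree_eq_natDegree, natDegree_orthoPoly h]
  intro e
  have := leadingCoeff_orthoPoly_pos h l
  simp [e] at this

theorem degree_X_mul_orthoPoly {μ : Measure ℝ} (h : IsAdmissible μ) (l : ℕ) :
    (X * orthoPoly μ l).degree = ((l + 1 : ℕ) : WithBot ℕ) := by
  rw [degree_mul, degree_X, degree_orthoPoly h, add_comm]
  rfl

/-- The three-term recurrence relation, where `p_{-1} = 0`. -/
theorem three_term_recurrence {μ : Measure ℝ} (h : IsAdmissible μ) (l : ℕ) :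
    X * orthoPoly μ l = C (recB μ (l + 1)) * orthoPoly μ (l + 1) + C (recA μ l) * orthoPoly μ l
      + C (recB μ l) * (if l = 0 then 0 else orthoPoly μ (l - 1)) := by
  set D : ℝ[X] := X * orthoPoly μ l - (C (recB μ (l + 1)) * orthoPoly μ (l + 1)
    + C (recA μ l) * orthoPoly μ l
      + C (recB μ l) * (if l = 0 then 0 else orthoPoly μ (l - 1))) with hD
  have hz : ∀ j < l + 2, ip μ (orthoPoly μ j) D = 0 := by
    intro j hj
    rw [ip_comm, hD, h.ip_sub, h.ip_add, h.ip_add, ip_C_mul, ip_C_mul, ip_C_mul,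
      ip_orthoPoly h, ip_orthoPoly h]
    rcases l with _ | l
    · obtain rfl | rfl : j = 0 ∨ j = 1 := by omega
      · simp [recA, recB]
      · simp [recB]
    · simp only [Nat.add_eq_zero_iff, one_ne_zero, and_false, if_false, Nat.add_sub_cancel]
      rw [ip_orthoPoly h]
      by_cases h1 : j = l + 1 + 1
      · subst h1; simp [recB]; omega
      by_cases h2 : j = l + 1
      · subst h2; simp [recA]
      by_cases h3 : j = l
      · subst h3
        simp [recB, ip_X_mul, ip_comm μ (orthoPoly μ (j + 1))]; omega
      · have : ip μ (X * orthoPoly μ (l + 1)) (orthoPoly μ j) = 0 := by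
          rw [ip_X_mul, ip_comm]
          apply ip_orthoPoly_of_degree_lt h
          rw [degree_X_mul_orthoPoly h]
          have : j + 1 < l + 1 := by omega
          exact_mod_cast this
        rw [this, if_neg (by omega), if_neg (by omega), if_neg (by omega)]
        simp
  have hdeg : D.degree < ((l + 2 : ℕ) : WithBot ℕ) := by
    have e1 : ((l + 1 : ℕ) : WithBot ℕ) < ((l + 2 : ℕ) : WithBot ℕ) := by
      exact_mod_cast Nat.lt_succ_self (l + 1)
    have e2 : ∀ j ≤ l + 1, ∀ c : ℝ, (C c * orthoPoly μ j).degree < ((l + 2 : ℕ) : WithBot ℕ) := by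
      intro j hj c
      refine (degree_C_mul_le_degree _ _).trans_lt ?_
      rw [degree_orthoPoly h]
      exact_mod_cast Nat.lt_succ_of_le hj
    refine (degree_sub_le _ _).trans_lt (max_lt ?_ ?_)
    · rw [degree_X_mul_orthoPoly h]; exact e1
    · refine (degree_add_le _ _).trans_lt (max_lt ?_ ?_)
      · exact (degree_add_le _ _).trans_lt (max_lt (e2 _ le_rfl _) (e2 _ (by omega) _))
      · split_ifs
        · rw [mul_zero, degree_zero]; exact WithBot.bot_lt_coe _
        · exact e2 _ (by omega) _
  have hDD : ip μ D D = 0 := ip_eq_zero_of_forall_lt h D (l + 2) hz D hdeg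
  have hD0 : D = 0 := by
    by_contra hne
    exact (h.ip_self_pos hne).ne' hDD
  exact sub_eq_zero.1 hD0

theorem recB_succ_pos {μ : Measure ℝ} (h : IsAdmissible μ) (l : ℕ) : 0 < recB μ (l + 1) := by
  have h1 := congrArg (fun q : ℝ[X] => q.coeff (l + 1)) (three_term_recurrence h l)
  have hc : ∀ j, (orthoPoly μ j).coeff j = (orthoPoly μ j).leadingCoeff := fun j => by
    rw [leadingCoeff, natDegree_orthoPoly h]
  have h2 : (if l = 0 then (0 : ℝ[X]) else orthoPoly μ (l - 1)).coeff (l + 1) = 0 := by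
    split_ifs
    · simp
    · exact coeff_eq_zero_of_natDegree_lt (by rw [natDegree_orthoPoly h]; omega)
  have h3 : (orthoPoly μ l).coeff (l + 1) = 0 :=
    coeff_eq_zero_of_natDegree_lt (by rw [natDegree_orthoPoly h]; omega)
  simp only [coeff_X_mul, coeff_add, coeff_C_mul, h2, h3, hc, mul_zero, add_zero] at h1
  have h4 := leadingCoeff_orthoPoly_pos h l
  rw [h1] at h4
  exact pos_of_mul_pos_left h4 (leadingCoeff_orthoPoly_pos h (l + 1)).le

theorem not_dvd_of_nonneg {μ : Measure ℝ} (h : IsAdmissible μ) (l : ℕ) (g : ℝ[X])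
    (hg : g.natDegree = 2) (h0 : ∀ x, 0 ≤ g.eval x) : ¬ g ∣ orthoPoly μ l := by
  rintro ⟨q, hq⟩
  have hp : orthoPoly μ l ≠ 0 := by
    intro e
    have := leadingCoeff_orthoPoly_pos h l
    simp [e] at this
  have hg0 : g ≠ 0 := by rintro rfl; simp at hg
  have hq0 : q ≠ 0 := by rintro rfl; simp [hp] at hq
  have hd : 2 + q.natDegree = l := by
    rw [← hg, ← natDegree_mul hg0 hq0, ← hq, natDegree_orthoPoly h]
  have hz : ip μ q (orthoPoly μ l) = 0 := by
    apply ip_orthoPoly_of_degree_lt h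
    refine degree_le_natDegree.trans_lt ?_
    have : q.natDegree < l := by omega
    exact_mod_cast this
  have hpos := h.integral_pos (q := g * (q * q)) (mul_ne_zero hg0 (mul_ne_zero hq0 hq0))
    (fun x => by
      rw [eval_mul, eval_mul]
      exact mul_nonneg (h0 x) (mul_self_nonneg _))
  have : ip μ q (orthoPoly μ l) = ∫ x, (g * (q * q)).eval x ∂μ := by
    rw [ip, hq]
    congr 1; ext x
    simp only [eval_mul]; ring
  rw [← this, hz] at hpos
  exact lt_irrefl _ hpos

/-- All `l` zeros of the orthonormal polynomial of degree `l` are real. -/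
theorem card_roots_orthoPoly {μ : Measure ℝ} (h : IsAdmissible μ) (l : ℕ) :
    Multiset.card (orthoPoly μ l).roots = l := by
  obtain ⟨q, hq, hcard, hroots⟩ := exists_prod_multiset_X_sub_C_mul (orthoPoly μ l)
  rw [natDegree_orthoPoly h] at hcard
  by_cases hd : q.natDegree = 0
  · rwa [hd, add_zero] at hcard
  exfalso
  have hq0 : q ≠ 0 := by rintro rfl; simp at hd
  obtain ⟨z, hz⟩ := IsAlgClosed.exists_aeval_eq_zero ℂ q (by
    rw [degree_eq_natDegree hq0]; exact_mod_cast hd)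
  have him : z.im ≠ 0 := by
    intro h0
    have hz' : z = ((z.re : ℝ) : ℂ) := by apply Complex.ext <;> simp [h0]
    have hr : q.IsRoot z.re := by
      rw [hz'] at hz
      have : aeval ((algebraMap ℝ ℂ) z.re) q = 0 := hz
      rw [aeval_algebraMap_apply] at this
      simpa using this
    have := (mem_roots hq0).2 hr
    simp [hroots] at this
  have hdvd := quadratic_dvd_of_aeval_eq_zero_im_ne_zero q hz him
  refine not_dvd_of_nonneg h l _ ?_ ?_ (hdvd.trans (Dvd.intro_left _ hq))
  · compute_degree!
  · intro x
    have hn : ‖z‖ ^ 2 = z.re ^ 2 + z.im ^ 2 := by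
      rw [← Complex.normSq_eq_norm_sq, Complex.normSq_apply]; ring
    simp only [eval_add, eval_sub, eval_mul, eval_pow, eval_X, eval_C, hn]
    nlinarith [sq_nonneg (x - z.re), sq_nonneg z.im]

/-- The zeros of an orthonormal polynomial are simple. -/
theorem nodup_roots_orthoPoly {μ : Measure ℝ} (h : IsAdmissible μ) (l : ℕ) :
    (orthoPoly μ l).roots.Nodup := by
  rw [Multiset.nodup_iff_count_le_one]
  intro r
  by_contra hr
  push Not at hr
  have hp : orthoPoly μ l ≠ 0 := by
    intro e
    have := leadingCoeff_orthoPoly_pos h l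
    simp [e] at this
  rw [count_roots] at hr
  refine not_dvd_of_nonneg h l ((X - C r) ^ 2) ?_ ?_ ((le_rootMultiplicity_iff hp).1 hr)
  · simp
  · intro x
    rw [eval_pow]; exact sq_nonneg _

end Properties

/-! ### Summation methods and the mean Nevai class -/

/-- A regular summation method `S_n(y) = ∑_{k ≤ n} σ_{n,k} y_k`. -/
structure RegularSummation where
  weight : ℕ → ℕ → ℝ
  nonneg : ∀ n k, k ≤ n → 0 ≤ weight n k
  sum_eq_one : ∀ n, ∑ k ∈ Finset.range (n + 1), weight n k = 1
  tendsto_zero : ∀ k, Tendsto (fun n => weight n k) atTop (𝓝 0)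

/-- The arithmetic mean, i.e. the Cesàro method `(C,1)`, with weights `σ_{n,k} = 1 / (n + 1)`. -/
def arithmeticMean : RegularSummation where
  weight n _ := 1 / ((n : ℝ) + 1)
  nonneg n _ _ := by positivity
  sum_eq_one n := by
    have : (n : ℝ) + 1 ≠ 0 := by positivity
    simp [this]
  tendsto_zero _ := tendsto_one_div_add_atTop_nhds_zero_nat

/-- The mean Nevai class `M^{(S)}(Σ_{l_a,l_b})`, for families of measures indexed by `ℕ`. -/
structure MeanNevaiClass (S : RegularSummation) (Sig : ℕ → ℕ → ℝ) (μ : ℕ → Measure ℝ) : Prop where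
  bounded_a : ∃ A : ℝ, ∀ n k, |recA (μ k) n| ≤ A
  bounded_b : ∃ B : ℝ, ∀ n k, |recB (μ k) n| ≤ B
  shift_a : ∀ l : ℕ, Tendsto (fun n : ℕ => ∑ k ∈ Finset.range (n + 1),
    S.weight n k * |recA (μ (n - k)) (k + l) - recA (μ (n - k)) k|) atTop (𝓝 0)
  shift_b : ∀ l : ℕ, Tendsto (fun n : ℕ => ∑ k ∈ Finset.range (n + 1),
    S.weight n k * |recB (μ (n - k)) (k + l) - recB (μ (n - k)) k|) atTop (𝓝 0)
  moments : ∀ la lb : ℕ, Tendsto (fun n : ℕ => ∑ k ∈ Finset.range (n + 1),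
    S.weight n k * (recA (μ (n - k)) k ^ la * recB (μ (n - k)) k ^ lb)) atTop (𝓝 (Sig la lb))

/-! ### The mean measures and weak convergence -/

/-- The mean measure `∑_{k ≤ n} σ_{n,k} (p_k^{(n-k)})² dμ^{(n-k)}`. -/
def meanMeasure (S : RegularSummation) (μ : ℕ → Measure ℝ) (n : ℕ) : Measure ℝ :=
  ∑ k ∈ Finset.range (n + 1), ENNReal.ofReal (S.weight n k) •
    (μ (n - k)).withDensity (fun x => ENNReal.ofReal ((orthoPoly (μ (n - k)) k).eval x ^ 2))

/-- The mean zero distribution `ν_{n+1}` of the arithmetic mean: the `(n+1)(n+2)/2` zeros of the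
polynomials `p_{k+1}^{(n-k)}`, `0 ≤ k ≤ n`, all carry the mass `2 / ((n+1)(n+2))`. -/
def zeroMeasure (μ : ℕ → Measure ℝ) (n : ℕ) : Measure ℝ :=
  ENNReal.ofReal (2 / (((n : ℝ) + 1) * ((n : ℝ) + 2))) • ∑ k ∈ Finset.range (n + 1),
    ((orthoPoly (μ (n - k)) (k + 1)).roots.map (fun x => Measure.dirac x)).sum

/-- Weak convergence of a sequence of probability measures on `ℝ` to a probability measure. -/
def ConvergesWeakly (m : ℕ → Measure ℝ) (m' : Measure ℝ) : Prop :=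
  ∃ (h : ∀ n, IsProbabilityMeasure (m n)) (h' : IsProbabilityMeasure m'),
    Tendsto (β := ProbabilityMeasure ℝ) (fun n => ⟨m n, h n⟩) atTop (𝓝 ⟨m', h'⟩)

/-- `m` is the equilibrium measure of the family: the weak limit of the mean measures. -/
def IsEquilibriumMeasure (S : RegularSummation) (μ : ℕ → Measure ℝ) (m : Measure ℝ) : Prop :=
  ConvergesWeakly (meanMeasure S μ) m

/-- The uniform probability measure on `[-1, 1]`. -/
def uniformMeasure : Measure ℝ := (2⁻¹ : ℝ≥0∞) • volume.restrict (Set.Icc (-1) 1)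

/-- The limit values `δ_{0,l_a} 2^{-l_b} Γ(3/2) Γ((l_b+2)/2) / Γ((l_b+3)/2)`. -/
def legendreSigma (la lb : ℕ) : ℝ :=
  if la = 0 then
    Real.Gamma (3 / 2) / 2 ^ lb * (Real.Gamma (((lb : ℝ) + 2) / 2) / Real.Gamma (((lb : ℝ) + 3) / 2))
  else 0

end MeanNevai

end

/-!
Everything is reduced to moments. Write `J` for the Jacobi matrix of a measure, so that
`ip μ (X ^ m * p_k) p_i` is the entry `(J ^ m)_{k,i}`, a sum over walks of length `m` from `k` to
`i` weighted by recurrence coefficients.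

*Mean measures.* If the coefficients near `k` were `a = 0` and `b = b_k`, the diagonal entry of
`J ^ m` would be `b_k ^ m` times the number of closed walks of length `m` with steps `±1` on the
integers. The error is at most a multiple of the deviation of the coefficients with
nearby indices from these values (`abs_ip_sub_walkCount_le`), and by the hypotheses on the shifts
and `Σ_{2,0} = 0` that deviation vanishes in the mean. Hence the moments of the mean measures
converge (`tendsto_diagMean_ip_X_pow`) to `walkCount m 0 * Σ_{0,m}`, which by a recursion for the
central binomial coefficients is the `m`-th moment of the uniform distribution
(`walkCount_mul_legendreSigma`).

*Zeros.* Gauss quadrature at the zeros of `p_N`, together with the identity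
`λ_x ∑_{i < N} p_i(x)² = 1` for its weights, shows that the power sum `∑ x ^ m` of the zeros differs
from `∑_{i < N} (J ^ m)_{i,i}` by a quantity bounded in `N` (`abs_sum_pow_sub_sum_ip_le`). Summing
along the rows of a triangle of indices is the same as summing along its antidiagonals, so the
moments of the mean zero distributions are, up to a vanishing error, means of the moments of the
mean measures with weights proportional to `N + 1`; they have the same limits
(`tendsto_mean_sum_zeroSet_pow`).

*Conclusion.* The bound on the recurrence coefficients confines all measures and all zeros to one
compact interval (`ae_abs_lt_of_recurrence_bounded`, `abs_le_of_mem_zeroSet`), so Weierstrass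
approximation extends the convergence to all continuous functions
(`tendsto_integral_of_tendsto_moments`). Functions given on `[-1, 1]` only are extended by
constants; the portmanteau theorem shows that the mass outside `[-1, 1]` vanishes in the limit
(`tendsto_setIntegral_Icc`).
-/

namespace MeanNevai

/-! ### Matrix entries of powers of the Jacobi operator -/

theorem ip_X_pow_succ {μ : Measure ℝ} (h : IsAdmissible μ) (f : ℝ[X]) (m i : ℕ) :
    ip μ (X ^ (m + 1) * f) (orthoPoly μ i) =
      recB μ (i + 1) * ip μ (X ^ m * f) (orthoPoly μ (i + 1))
        + recA μ i * ip μ (X ^ m * f) (orthoPoly μ i)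
        + recB μ i * (if i = 0 then 0 else ip μ (X ^ m * f) (orthoPoly μ (i - 1))) := by
  rw [pow_succ', mul_assoc, ip_X_mul, ip_comm, three_term_recurrence h, h.ip_add, h.ip_add,
    ip_C_mul, ip_C_mul, ip_C_mul, ip_comm μ (orthoPoly μ (i + 1)), ip_comm μ (orthoPoly μ i)]
  split_ifs
  · simp [ip]
  · rw [ip_comm μ (orthoPoly μ (i - 1))]

theorem abs_ip_X_pow_le {μ : Measure ℝ} (h : IsAdmissible μ) {M : ℝ}
    (ha : ∀ n, |recA μ n| ≤ M) (hb : ∀ n, |recB μ n| ≤ M) (k m i : ℕ) :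
    |ip μ (X ^ m * orthoPoly μ k) (orthoPoly μ i)| ≤ (3 * M) ^ m := by
  have hM : 0 ≤ M := (abs_nonneg _).trans (ha 0)
  induction m generalizing i with
  | zero =>
    rw [pow_zero, one_mul, ip_orthoPoly h]
    split_ifs <;> simp
  | succ m ih =>
    rw [ip_X_pow_succ h]
    have e3 : |if i = 0 then (0 : ℝ) else ip μ (X ^ m * orthoPoly μ k) (orthoPoly μ (i - 1))|
        ≤ (3 * M) ^ m := by
      split_ifs
      · simpa using pow_nonneg (by positivity : 0 ≤ 3 * M) m
      · exact ih _
    refine (abs_add_three _ _ _).trans ?_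
    rw [abs_mul, abs_mul, abs_mul]
    calc _ ≤ M * (3 * M) ^ m + M * (3 * M) ^ m + M * (3 * M) ^ m := by
          gcongr
          · exact hb _
          · exact ih _
          · exact ha _
          · exact ih _
          · exact hb _
      _ = (3 * M) ^ (m + 1) := by ring

/-- The number of walks of length `m` from `0` to `d` on the integers with steps `±1`. -/
noncomputable def walkCount : ℕ → ℤ → ℝ
  | 0, d => if d = 0 then 1 else 0
  | m + 1, d => walkCount m (d + 1) + walkCount m (d - 1)

theorem walkCount_of_lt (m : ℕ) (d : ℤ) (hd : d < -m) : walkCount m d = 0 := by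
  induction m generalizing d with
  | zero => rw [walkCount, if_neg]; push_cast at hd; omega
  | succ m ih =>
    push_cast at hd
    rw [walkCount, ih _ (by omega), ih _ (by omega), add_zero]

theorem walkCount_of_odd (m : ℕ) (d : ℤ) (hd : Odd (m + d)) : walkCount m d = 0 := by
  induction m generalizing d with
  | zero =>
    rw [walkCount, if_neg]
    rintro rfl
    simp at hd
  | succ m ih =>
    push_cast at hd
    rw [walkCount, ih, ih, add_zero]
    · grind
    · grind

theorem walkCount_eq_choose (m u : ℕ) : walkCount m (2 * u - m) = m.choose u := by
  induction m generalizing u with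
  | zero =>
    rcases u with _ | u
    · simp [walkCount]
    · rw [walkCount, if_neg (by push_cast; omega)]; simp
  | succ m ih =>
    have e : (2 * (u : ℤ) - (m + 1 : ℕ) + 1) = 2 * u - m := by push_cast; ring
    rw [walkCount, e, ih]
    rcases u with _ | u
    · rw [walkCount_of_lt _ _ (by push_cast; omega)]; simp
    · have e' : (2 * ((u + 1 : ℕ) : ℤ) - (m + 1 : ℕ) - 1) = 2 * u - m := by push_cast; ring
      rw [e', ih, Nat.choose_succ_succ]
      push_cast; ring

theorem walkCount_two_mul (q : ℕ) : walkCount (2 * q) 0 = q.centralBinom := by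
  have := walkCount_eq_choose (2 * q) q
  rw [Nat.centralBinom, ← this]
  congr 1
  push_cast; ring

/-- The total deviation of the recurrence coefficients with indices in `[k, k + L)` from the
constant coefficients `a = 0`, `b = b_k`. -/
noncomputable def localDeviation (μ : Measure ℝ) (L k : ℕ) : ℝ :=
  ∑ i ∈ Finset.range L, (|recA μ (k + i)| + |recB μ (k + i) - recB μ k|)

theorem abs_recA_le_localDeviation (μ : Measure ℝ) {L k i : ℕ} (h1 : k ≤ i) (h2 : i < k + L) :
    |recA μ i| ≤ localDeviation μ L k := by
  obtain ⟨j, rfl⟩ := Nat.exists_eq_add_of_le h1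
  refine le_trans (le_add_of_nonneg_right (abs_nonneg (recB μ (k + j) - recB μ k))) ?_
  exact Finset.single_le_sum (f := fun i => |recA μ (k + i)| + |recB μ (k + i) - recB μ k|)
    (fun _ _ => by positivity) (Finset.mem_range.2 (by omega))

theorem abs_recB_sub_le_localDeviation (μ : Measure ℝ) {L k i : ℕ} (h1 : k ≤ i)
    (h2 : i < k + L) : |recB μ i - recB μ k| ≤ localDeviation μ L k := by
  obtain ⟨j, rfl⟩ := Nat.exists_eq_add_of_le h1
  refine le_trans (le_add_of_nonneg_left (abs_nonneg (recA μ (k + j)))) ?_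
  exact Finset.single_le_sum (f := fun i => |recA μ (k + i)| + |recB μ (k + i) - recB μ k|)
    (fun _ _ => by positivity) (Finset.mem_range.2 (by omega))

/-- The constant in the comparison of a Jacobi operator with the one with constant coefficients. -/
noncomputable def walkErrorConst (M : ℝ) : ℕ → ℝ
  | 0 => 0
  | m + 1 => 3 * (3 * M) ^ m + 2 * M * walkErrorConst M m

/-- Near the index `k` the entries of the powers of the Jacobi operator are those of the operator
with `a = 0` and constant off-diagonal entries `b_k`, up to a multiple of the local deviation.
The admissible indices `i` shrink by one at both ends for each factor `X`. -/
theorem abs_ip_sub_walkCount_le {μ : Measure ℝ} (h : IsAdmissible μ) {M : ℝ}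
    (ha : ∀ n, |recA μ n| ≤ M) (hb : ∀ n, |recB μ n| ≤ M) (k j L m i : ℕ)
    (h1 : k + m ≤ i) (h2 : i + m < k + L) :
    |ip μ (X ^ m * orthoPoly μ j) (orthoPoly μ i) - recB μ k ^ m * walkCount m ((i : ℤ) - j)|
      ≤ walkErrorConst M m * localDeviation μ L k := by
  have hM : 0 ≤ M := (abs_nonneg _).trans (ha 0)
  induction m generalizing i with
  | zero =>
    have : (if j = i then (1 : ℝ) else 0) = if (i : ℤ) - j = 0 then 1 else 0 := by
      congr 1; apply propext; omega
    simp only [pow_zero, one_mul, ip_orthoPoly h, walkCount, this, walkErrorConst]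
    simp
  | succ m ih =>
    obtain ⟨i, rfl⟩ : ∃ i', i = i' + 1 := ⟨i - 1, by omega⟩
    have E1 := ih (i + 1 + 1) (by omega) (by omega)
    have E2 := ih i (by omega) (by omega)
    rw [ip_X_pow_succ h, walkCount, if_neg (by omega), Nat.add_sub_cancel]
    have c1 : (((i + 1 : ℕ) : ℤ) - j + 1) = ((i + 1 + 1 : ℕ) : ℤ) - j := by push_cast; ring
    have c2 : (((i + 1 : ℕ) : ℤ) - j - 1) = (i : ℤ) - j := by push_cast; ring
    rw [c1, c2]
    set D := localDeviation μ L k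
    have hA : |recA μ (i + 1)| ≤ D := abs_recA_le_localDeviation μ (by omega) (by omega)
    have hB1 : |recB μ (i + 1) - recB μ k| ≤ D :=
      abs_recB_sub_le_localDeviation μ (by omega) (by omega)
    have hB2 : |recB μ (i + 1 + 1) - recB μ k| ≤ D :=
      abs_recB_sub_le_localDeviation μ (by omega) (by omega)
    have v0 := abs_ip_X_pow_le h ha hb j m i
    have v1 := abs_ip_X_pow_le h ha hb j m (i + 1)
    have v2 := abs_ip_X_pow_le h ha hb j m (i + 1 + 1)
    have hbk := hb k
    set β := recB μ k
    set x0 := ip μ (X ^ m * orthoPoly μ j) (orthoPoly μ i)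
    set x1 := ip μ (X ^ m * orthoPoly μ j) (orthoPoly μ (i + 1))
    set x2 := ip μ (X ^ m * orthoPoly μ j) (orthoPoly μ (i + 1 + 1))
    set w0 := walkCount m ((i : ℤ) - j)
    set w2 := walkCount m (((i + 1 + 1 : ℕ) : ℤ) - j)
    have hD : 0 ≤ D := (abs_nonneg _).trans hA
    calc _ = |((recB μ (i + 1 + 1) - β) * x2 + recA μ (i + 1) * x1 + (recB μ (i + 1) - β) * x0)
            + (β * (x2 - β ^ m * w2) + β * (x0 - β ^ m * w0))| := by
          congr 1; ring
      _ ≤ (|recB μ (i + 1 + 1) - β| * |x2| + |recA μ (i + 1)| * |x1|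
            + |recB μ (i + 1) - β| * |x0|)
            + (|β| * |x2 - β ^ m * w2| + |β| * |x0 - β ^ m * w0|) := by
          simp only [← abs_mul]
          exact (abs_add_le _ _).trans (add_le_add (abs_add_three _ _ _) (abs_add_le _ _))
      _ ≤ (D * (3 * M) ^ m + D * (3 * M) ^ m + D * (3 * M) ^ m)
            + (M * (walkErrorConst M m * D) + M * (walkErrorConst M m * D)) := by
          gcongr
      _ = walkErrorConst M (m + 1) * D := by rw [walkErrorConst]; ring

/-! ### The limit moments -/

theorem centralBinom_mul_legendreSigma (q : ℕ) :
    (q.centralBinom : ℝ) * legendreSigma 0 (2 * q) = 1 / (2 * q + 1) := by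
  have key : ∀ q : ℕ, (q.centralBinom : ℝ) * (Real.Gamma (3 / 2) / 4 ^ q *
      (Real.Gamma (q + 1) / Real.Gamma (q + 3 / 2))) = 1 / (2 * q + 1) := by
    intro q
    induction q with
    | zero =>
      have : Real.Gamma (3 / 2) ≠ 0 := (Real.Gamma_pos_of_pos (by norm_num)).ne'
      simp [this]
    | succ q ih =>
      have g1 : Real.Gamma ((q + 1 : ℕ) + 1) = (q + 1) * Real.Gamma (q + 1) := by
        rw [Real.Gamma_add_one (by positivity)]; push_cast; rfl
      have g2 : Real.Gamma ((q + 1 : ℕ) + 3 / 2) = (q + 3 / 2) * Real.Gamma (q + 3 / 2) := by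
        rw [← Real.Gamma_add_one (by positivity)]; push_cast; congr 1; ring
      have hc : ((q : ℝ) + 1) * ((q + 1).centralBinom : ℝ) = 2 * (2 * q + 1) * q.centralBinom := by
        exact_mod_cast Nat.succ_mul_centralBinom_succ q
      have hc' : ((q + 1).centralBinom : ℝ) = 2 * (2 * q + 1) * q.centralBinom / (q + 1) := by
        rw [← hc]; field_simp
      have hG : Real.Gamma (q + 3 / 2) ≠ 0 := (Real.Gamma_pos_of_pos (by positivity)).ne'
      calc _ = (2 * q + 1) / (2 * q + 3) * ((q.centralBinom : ℝ) * (Real.Gamma (3 / 2) / 4 ^ q *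
            (Real.Gamma (q + 1) / Real.Gamma (q + 3 / 2)))) := by
            rw [g1, g2, hc', pow_succ]
            field_simp
            ring
        _ = _ := by
            rw [ih]; push_cast; field_simp; ring
  have e1 : (((2 * q : ℕ) : ℝ) + 2) / 2 = q + 1 := by push_cast; ring
  have e2 : (((2 * q : ℕ) : ℝ) + 3) / 2 = q + 3 / 2 := by push_cast; ring
  have e3 : (2 : ℝ) ^ 2 = 4 := by norm_num
  rw [← key q, legendreSigma, if_pos rfl, pow_mul, e1, e2, e3]

/-- The limit moments are the moments of the uniform distribution on `[-1, 1]`. -/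
theorem walkCount_mul_legendreSigma (m : ℕ) :
    walkCount m 0 * legendreSigma 0 m = 1 / 2 * ∫ x in (-1 : ℝ)..1, x ^ m := by
  rw [integral_pow]
  rcases Nat.even_or_odd' m with ⟨q, rfl | rfl⟩
  · rw [walkCount_two_mul, centralBinom_mul_legendreSigma, Odd.neg_one_pow ⟨q, rfl⟩]
    push_cast; ring
  · rw [walkCount_of_odd _ _ (by push_cast; exact ⟨q, by ring⟩),
      Even.neg_one_pow ⟨q + 1, by ring⟩]
    simp

/-! ### Arithmetic means along antidiagonals -/

/-- The arithmetic mean of the entries of `F` on the antidiagonal of index sum `n`. -/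
noncomputable def diagMean (F : ℕ → ℕ → ℝ) (n : ℕ) : ℝ :=
  ∑ k ∈ Finset.range (n + 1), 1 / ((n : ℝ) + 1) * F (n - k) k

theorem diagMean_add (F G : ℕ → ℕ → ℝ) (n : ℕ) :
    diagMean (fun s k => F s k + G s k) n = diagMean F n + diagMean G n := by
  simp only [diagMean, mul_add, Finset.sum_add_distrib]

theorem diagMean_sub (F G : ℕ → ℕ → ℝ) (n : ℕ) :
    diagMean (fun s k => F s k - G s k) n = diagMean F n - diagMean G n := by
  simp only [diagMean, mul_sub, Finset.sum_sub_distrib]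

theorem diagMean_const_mul (c : ℝ) (F : ℕ → ℕ → ℝ) (n : ℕ) :
    diagMean (fun s k => c * F s k) n = c * diagMean F n := by
  simp only [diagMean, Finset.mul_sum]
  exact Finset.sum_congr rfl fun k _ => by ring

theorem diagMean_sum {ι : Type*} (I : Finset ι) (F : ι → ℕ → ℕ → ℝ) (n : ℕ) :
    diagMean (fun s k => ∑ i ∈ I, F i s k) n = ∑ i ∈ I, diagMean (F i) n := by
  simp only [diagMean, Finset.mul_sum]
  exact Finset.sum_comm

theorem diagMean_mono {F G : ℕ → ℕ → ℝ} (h : ∀ s k, F s k ≤ G s k) (n : ℕ) :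
    diagMean F n ≤ diagMean G n :=
  Finset.sum_le_sum fun k _ => mul_le_mul_of_nonneg_left (h _ _) (by positivity)

theorem abs_diagMean_le (F : ℕ → ℕ → ℝ) (n : ℕ) :
    |diagMean F n| ≤ diagMean (fun s k => |F s k|) n := by
  refine (Finset.abs_sum_le_sum_abs _ _).trans (le_of_eq (Finset.sum_congr rfl fun k _ => ?_))
  rw [abs_mul, abs_of_nonneg (by positivity : (0 : ℝ) ≤ 1 / ((n : ℝ) + 1))]

theorem sq_diagMean_le (F : ℕ → ℕ → ℝ) (n : ℕ) :
    diagMean F n ^ 2 ≤ diagMean (fun s k => F s k ^ 2) n := by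
  have h := sq_sum_le_card_mul_sum_sq (s := Finset.range (n + 1)) (f := fun k => F (n - k) k)
  rw [Finset.card_range] at h
  push_cast at h
  have hn : (0 : ℝ) < (n : ℝ) + 1 := by positivity
  simp only [diagMean, ← Finset.mul_sum]
  rw [mul_pow]
  calc _ ≤ (1 / ((n : ℝ) + 1)) ^ 2 * (((n : ℝ) + 1) *
        ∑ k ∈ Finset.range (n + 1), F (n - k) k ^ 2) := by gcongr
    _ = _ := by field_simp

/-- Means along antidiagonals are not affected by an index shift. -/
theorem tendsto_diagMean_of_shift {F : ℕ → ℕ → ℝ} {B L : ℝ} (hB : ∀ s k, |F s k| ≤ B) (j : ℕ)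
    (h : Tendsto (diagMean fun s k => F s (k + j)) atTop (𝓝 L)) :
    Tendsto (diagMean F) atTop (𝓝 L) := by
  rw [← tendsto_add_atTop_iff_nat j]
  have hinv : Tendsto (fun n : ℕ => 1 / ((n : ℝ) + (j + 1 : ℝ))) atTop (𝓝 0) := by
    have := (tendsto_one_div_add_atTop_nhds_zero_nat (𝕜 := ℝ)).comp (tendsto_add_atTop_nat j)
    refine this.congr fun n => ?_
    simp only [Function.comp_apply]; push_cast; ring
  have hdec : ∀ n : ℕ, diagMean F (n + j) =
      (∑ k ∈ Finset.range j, F (n + j - k) k) * (1 / ((n : ℝ) + (j + 1)))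
        + (1 - j * (1 / ((n : ℝ) + (j + 1)))) * diagMean (fun s k => F s (k + j)) n := by
    intro n
    have e : n + j + 1 = j + (n + 1) := by ring
    simp only [diagMean, ← Finset.mul_sum]
    rw [e, Finset.sum_range_add]
    have e2 : ∀ k ∈ Finset.range (n + 1), F (n + j - (j + k)) (j + k) = F (n - k) (k + j) := by
      intro k _
      congr 1 <;> omega
    rw [Finset.sum_congr rfl e2]
    have : (n : ℝ) + (j + 1) ≠ 0 := by positivity
    have : (n : ℝ) + 1 ≠ 0 := by positivity
    push_cast
    field_simp
    ring
  simp only [hdec]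
  have t1 : Tendsto (fun n : ℕ => (∑ k ∈ Finset.range j, F (n + j - k) k) *
      (1 / ((n : ℝ) + (j + 1)))) atTop (𝓝 0) := by
    refine squeeze_zero_norm (a := fun n : ℕ => (j * B) * (1 / ((n : ℝ) + (j + 1)))) (fun n => ?_)
      (by simpa using hinv.const_mul (j * B))
    rw [norm_mul, Real.norm_eq_abs, Real.norm_eq_abs,
      abs_of_nonneg (by positivity : (0 : ℝ) ≤ 1 / ((n : ℝ) + (j + 1)))]
    gcongr
    refine (Finset.abs_sum_le_sum_abs _ _).trans ?_
    refine (Finset.sum_le_sum fun k _ => hB _ _).trans ?_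
    simp
  simpa using t1.add (((hinv.const_mul (j : ℝ)).const_sub 1).mul h)

/-! ### The moments of the mean measures -/

section Moments

variable {μ : ℕ → Measure ℝ}

theorem MeanNevaiClass.exists_bound (hc : MeanNevaiClass arithmeticMean legendreSigma μ) :
    ∃ M : ℝ, 1 ≤ M ∧ (∀ k n, |recA (μ k) n| ≤ M) ∧ ∀ k n, |recB (μ k) n| ≤ M := by
  obtain ⟨A, hA⟩ := hc.bounded_a
  obtain ⟨B, hB⟩ := hc.bounded_b
  exact ⟨max 1 (max A B), le_max_left _ _,
    fun k n => (hA n k).trans ((le_max_left _ _).trans (le_max_right _ _)),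
    fun k n => (hB n k).trans ((le_max_right _ _).trans (le_max_right _ _))⟩

/-- As `Σ_{2,0} = 0`, the diagonal recurrence coefficients vanish in the mean. -/
theorem tendsto_diagMean_abs_recA (hc : MeanNevaiClass arithmeticMean legendreSigma μ) (l : ℕ) :
    Tendsto (diagMean fun s k => |recA (μ s) (k + l)|) atTop (𝓝 0) := by
  have h2 : Tendsto (diagMean fun s k => |recA (μ s) k| ^ 2) atTop (𝓝 0) := by
    have := hc.moments 2 0
    simp only [legendreSigma, if_neg two_ne_zero] at this
    refine this.congr fun n => Finset.sum_congr rfl fun k _ => ?_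
    simp [arithmeticMean]
  have h1 : Tendsto (diagMean fun s k => |recA (μ s) k|) atTop (𝓝 0) := by
    have h3 := h2.sqrt
    rw [Real.sqrt_zero] at h3
    refine squeeze_zero (fun n => ?_) (fun n => Real.le_sqrt_of_sq_le (sq_diagMean_le _ n)) h3
    exact Finset.sum_nonneg fun k _ => by positivity
  have h4 : Tendsto (diagMean fun s k => |recA (μ s) (k + l) - recA (μ s) k|) atTop (𝓝 0) :=
    hc.shift_a l
  have h5 := h4.add h1
  rw [add_zero] at h5
  refine squeeze_zero (fun n => Finset.sum_nonneg fun k _ => by positivity) (fun n => ?_) h5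
  rw [← diagMean_add]
  refine diagMean_mono (fun s k => ?_) n
  linarith [abs_sub_abs_le_abs_sub (recA (μ s) (k + l)) (recA (μ s) k)]

theorem tendsto_diagMean_localDeviation (hc : MeanNevaiClass arithmeticMean legendreSigma μ)
    (L : ℕ) : Tendsto (diagMean fun s k => localDeviation (μ s) L k) atTop (𝓝 0) := by
  have : ∀ n, diagMean (fun s k => localDeviation (μ s) L k) n = ∑ i ∈ Finset.range L,
      (diagMean (fun s k => |recA (μ s) (k + i)|) n
        + diagMean (fun s k => |recB (μ s) (k + i) - recB (μ s) k|) n) := by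
    intro n
    simp only [localDeviation]
    rw [diagMean_sum]
    exact Finset.sum_congr rfl fun i _ => diagMean_add _ _ n
  rw [funext this, ← Finset.sum_const_zero (s := Finset.range L)]
  refine tendsto_finsetSum _ fun i _ => ?_
  rw [← add_zero (0 : ℝ)]
  exact (tendsto_diagMean_abs_recA hc i).add (hc.shift_b i)

/-- Convergence of the moments of the mean measures. -/
theorem tendsto_diagMean_ip_X_pow (hμ : ∀ k, IsAdmissible (μ k))
    (hc : MeanNevaiClass arithmeticMean legendreSigma μ) (m : ℕ) :
    Tendsto (diagMean fun s k => ip (μ s) (X ^ m * orthoPoly (μ s) k) (orthoPoly (μ s) k))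
      atTop (𝓝 (1 / 2 * ∫ x in (-1 : ℝ)..1, x ^ m)) := by
  obtain ⟨M, -, hA, hB⟩ := hc.exists_bound
  refine tendsto_diagMean_of_shift (fun s k => abs_ip_X_pow_le (hμ s) (hA s) (hB s) k m k) m ?_
  rw [← walkCount_mul_legendreSigma]
  set F : ℕ → ℕ → ℝ :=
    fun s k => ip (μ s) (X ^ m * orthoPoly (μ s) (k + m)) (orthoPoly (μ s) (k + m))
  have hmain : Tendsto (diagMean fun s k => walkCount m 0 * recB (μ s) k ^ m) atTop
      (𝓝 (walkCount m 0 * legendreSigma 0 m)) := by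
    simp_rw [funext (diagMean_const_mul (walkCount m 0) fun s k => recB (μ s) k ^ m)]
    refine ((hc.moments 0 m).congr fun n => Finset.sum_congr rfl fun k _ => ?_).const_mul _
    simp [arithmeticMean]
  have herr : Tendsto (diagMean fun s k => F s k - walkCount m 0 * recB (μ s) k ^ m) atTop
      (𝓝 0) := by
    have hE := (tendsto_diagMean_localDeviation hc (2 * m + 1)).const_mul (walkErrorConst M m)
    rw [mul_zero] at hE
    refine squeeze_zero_norm (fun n => (abs_diagMean_le _ n).trans ?_) hE
    rw [← diagMean_const_mul]
    refine diagMean_mono (fun s k => ?_) n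
    have := abs_ip_sub_walkCount_le (hμ s) (hA s) (hB s) k (k + m) (2 * m + 1) m (k + m) le_rfl
      (by omega)
    rw [sub_self, mul_comm (recB (μ s) k ^ m)] at this
    exact this
  have := herr.add hmain
  rw [zero_add] at this
  refine this.congr fun n => ?_
  rw [diagMean_sub]; ring

end Moments

/-! ### Gauss quadrature and the power sums of the zeros -/

section Quadrature

variable {μ : Measure ℝ}

/-- The set of zeros of the orthonormal polynomial of degree `N`. -/
noncomputable def zeroSet (μ : Measure ℝ) (N : ℕ) : Finset ℝ := (orthoPoly μ N).roots.toFinset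

theorem orthoPoly_ne_zero (h : IsAdmissible μ) (N : ℕ) : orthoPoly μ N ≠ 0 :=
  leadingCoeff_ne_zero.1 (leadingCoeff_orthoPoly_pos h N).ne'

theorem card_zeroSet (h : IsAdmissible μ) (N : ℕ) : (zeroSet μ N).card = N := by
  rw [zeroSet, Multiset.toFinset_card_of_nodup (nodup_roots_orthoPoly h N),
    card_roots_orthoPoly h]

theorem eval_eq_zero_of_mem_zeroSet {N : ℕ} {x : ℝ} (hx : x ∈ zeroSet μ N) :
    (orthoPoly μ N).eval x = 0 :=
  isRoot_of_mem_roots (Multiset.mem_toFinset.1 hx)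

theorem sum_roots_map_eq (h : IsAdmissible μ) (N : ℕ) (f : ℝ → ℝ) :
    ((orthoPoly μ N).roots.map f).sum = ∑ x ∈ zeroSet μ N, f x := by
  rw [zeroSet, Finset.sum, Multiset.toFinset_val, (nodup_roots_orthoPoly h N).dedup]

/-- The weight of the zero `x` in the Gauss quadrature formula. -/
noncomputable def gaussWeight (μ : Measure ℝ) (N : ℕ) (x : ℝ) : ℝ :=
  ∫ t, (Lagrange.basis (zeroSet μ N) id x).eval t ∂μ

/-- The Gauss quadrature formula: exact for all polynomials of degree less than `2N`. -/
theorem integral_eq_sum_gaussWeight (h : IsAdmissible μ) (N : ℕ) (r : ℝ[X])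
    (hr : r.degree < ((2 * N : ℕ) : WithBot ℕ)) :
    ∫ t, r.eval t ∂μ = ∑ x ∈ zeroSet μ N, gaussWeight μ N x * r.eval x := by
  set p := orthoPoly μ N with hp
  have hp0 : p ≠ 0 := orthoPoly_ne_zero h N
  have hdiv : r = p * (r / p) + r % p := (EuclideanDomain.div_add_mod r p).symm
  have hmod : (r % p).degree < ((zeroSet μ N).card : WithBot ℕ) := by
    rw [card_zeroSet h, ← degree_orthoPoly h]
    exact EuclideanDomain.mod_lt r hp0
  have hq : (r / p).degree < (N : WithBot ℕ) := by
    by_cases hlt : r.degree < p.degree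
    · rw [(Polynomial.div_eq_zero_iff hp0).2 hlt, degree_zero]; exact WithBot.bot_lt_coe _
    · have hadd := degree_add_div hp0 (not_lt.1 hlt)
      have hq0 : r / p ≠ 0 := fun e => hlt ((Polynomial.div_eq_zero_iff hp0).1 e)
      rw [hp, degree_orthoPoly h, ← hp, degree_eq_natDegree hq0] at hadd
      rw [← hadd] at hr
      rw [degree_eq_natDegree hq0]
      have : N + (r / p).natDegree < 2 * N := by exact_mod_cast hr
      have : (r / p).natDegree < N := by omega
      exact_mod_cast this
  have hz : ∫ t, (p * (r / p)).eval t ∂μ = 0 := by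
    have := ip_orthoPoly_of_degree_lt h N _ hq
    rw [ip] at this
    rw [← this]
    congr 1; ext t; rw [eval_mul, mul_comm]
  have hev : ∀ x ∈ zeroSet μ N, (r % p).eval x = r.eval x := by
    intro x hx
    conv_rhs => rw [hdiv]
    rw [eval_add, eval_mul, hp, eval_eq_zero_of_mem_zeroSet hx, zero_mul, zero_add]
  have hint : ∫ t, r.eval t ∂μ = ∫ t, (r % p).eval t ∂μ := by
    conv_lhs => rw [hdiv]
    simp only [eval_add]
    rw [integral_add (h.integrable (p * (r / p)).continuous) (h.integrable (r % p).continuous),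
      hz, zero_add]
  rw [hint, Lagrange.eq_interpolate (s := zeroSet μ N) (v := id) (f := r % p)
    (Set.injOn_id _) hmod, Lagrange.interpolate_apply]
  simp only [eval_finsetSum, eval_mul, eval_C, id]
  rw [integral_finsetSum _ fun x _ => (h.integrable (Polynomial.continuous _)).const_mul _]
  refine Finset.sum_congr rfl fun x hx => ?_
  rw [integral_const_mul, hev x hx, mul_comm]; rfl

theorem degree_lagrangeBasis_zeroSet (h : IsAdmissible μ) {N : ℕ} {x : ℝ}
    (hx : x ∈ zeroSet μ N) :
    (Lagrange.basis (zeroSet μ N) id x).degree = ((N - 1 : ℕ) : WithBot ℕ) := by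
  rw [Lagrange.degree_basis (Set.injOn_id _) hx, card_zeroSet h]

theorem pos_of_mem_zeroSet (h : IsAdmissible μ) {N : ℕ} {x : ℝ} (hx : x ∈ zeroSet μ N) :
    0 < N := by
  rw [← card_zeroSet h N]; exact Finset.card_pos.2 ⟨x, hx⟩

theorem eval_lagrangeBasis_zeroSet {N : ℕ} {x y : ℝ}
    (hx : x ∈ zeroSet μ N) (hy : y ∈ zeroSet μ N) :
    (Lagrange.basis (zeroSet μ N) id x).eval y = if y = x then 1 else 0 := by
  split_ifs with e
  · subst e; exact Lagrange.eval_basis_self (v := id) (Set.injOn_id _) hx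
  · exact Lagrange.eval_basis_of_ne (v := id) (Ne.symm e) hy

theorem gaussWeight_nonneg (h : IsAdmissible μ) {N : ℕ} {x : ℝ} (hx : x ∈ zeroSet μ N) :
    0 ≤ gaussWeight μ N x := by
  set e := Lagrange.basis (zeroSet μ N) id x
  have hN := pos_of_mem_zeroSet h hx
  have h1 := integral_eq_sum_gaussWeight h N (e * e) (by
    rw [degree_mul, degree_lagrangeBasis_zeroSet h hx]
    have : N - 1 + (N - 1) < 2 * N := by omega
    exact_mod_cast this)
  rw [Finset.sum_eq_single_of_mem x hx fun y hy hne => by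
      rw [eval_mul, eval_lagrangeBasis_zeroSet hx hy, if_neg hne]; simp,
    eval_mul, eval_lagrangeBasis_zeroSet hx hx, if_pos rfl, mul_one, mul_one] at h1
  rw [← h1]
  exact integral_nonneg fun t => by rw [eval_mul]; exact mul_self_nonneg _

/-- The weights are the Christoffel numbers. The expansion of the Lagrange polynomial of the zero
`x` in the orthonormal polynomials has the coefficients `gaussWeight μ N x * p_i(x)`. -/
theorem gaussWeight_mul_sum_sq (h : IsAdmissible μ) {N : ℕ} {x : ℝ} (hx : x ∈ zeroSet μ N) :
    ∑ i ∈ Finset.range N, gaussWeight μ N x * (orthoPoly μ i).eval x ^ 2 = 1 := by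
  have hN := pos_of_mem_zeroSet h hx
  set e := Lagrange.basis (zeroSet μ N) id x with he
  set D : ℝ[X] := e - ∑ i ∈ Finset.range N,
    C (gaussWeight μ N x * (orthoPoly μ i).eval x) * orthoPoly μ i with hD
  have hedeg : e.degree < (N : WithBot ℕ) := by
    rw [he, degree_lagrangeBasis_zeroSet h hx]
    exact_mod_cast Nat.sub_lt hN one_pos
  have hdeg : D.degree < (N : WithBot ℕ) := by
    refine (degree_sub_le _ _).trans_lt (max_lt hedeg ?_)
    refine (degree_sum_le _ _).trans_lt ((Finset.sup_lt_iff (WithBot.bot_lt_coe N)).2 ?_)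
    intro i hi
    refine (degree_C_mul_le_degree _ _).trans_lt ?_
    rw [degree_orthoPoly h]
    exact WithBot.coe_lt_coe.2 (Finset.mem_range.1 hi)
  have hort : ∀ j < N, ip μ (orthoPoly μ j) D = 0 := by
    intro j hj
    have h1 : ip μ e (orthoPoly μ j) = gaussWeight μ N x * (orthoPoly μ j).eval x := by
      have := integral_eq_sum_gaussWeight h N (e * orthoPoly μ j) (by
        rw [degree_mul, he, degree_lagrangeBasis_zeroSet h hx, degree_orthoPoly h]
        have : N - 1 + j < 2 * N := by omega
        exact_mod_cast this)
      rw [Finset.sum_eq_single_of_mem x hx fun y hy hne => by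
          rw [eval_mul, eval_lagrangeBasis_zeroSet hx hy, if_neg hne]; simp,
        eval_mul, eval_lagrangeBasis_zeroSet hx hx, if_pos rfl, one_mul] at this
      rw [← this, ip]
      simp only [eval_mul]
    rw [ip_comm, hD, h.ip_sub, h1, h.ip_sum]
    simp only [ip_C_mul, ip_orthoPoly h]
    simp [hj]
  have hDD : ip μ D D = 0 := ip_eq_zero_of_forall_lt h D N hort D hdeg
  have hD0 : D = 0 := by
    by_contra hne
    exact (h.ip_self_pos hne).ne' hDD
  have := congrArg (eval x) hD0
  rw [hD, eval_sub, he, eval_lagrangeBasis_zeroSet hx hx, if_pos rfl, eval_zero,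
    eval_finsetSum, sub_eq_zero] at this
  rw [this]
  exact Finset.sum_congr rfl fun i _ => by rw [eval_mul, eval_C]; ring

theorem sum_gaussWeight_mul_sq (h : IsAdmissible μ) {N i : ℕ} (hi : i < N) :
    ∑ x ∈ zeroSet μ N, gaussWeight μ N x * (orthoPoly μ i).eval x ^ 2 = 1 := by
  have := integral_eq_sum_gaussWeight h N (orthoPoly μ i * orthoPoly μ i) (by
    rw [degree_mul, degree_orthoPoly h]
    have : i + i < 2 * N := by omega
    exact_mod_cast this)
  simp only [eval_mul] at this
  change ip μ _ _ = _ at this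
  rw [ip_orthoPoly h, if_pos rfl] at this
  rw [this]
  exact Finset.sum_congr rfl fun x _ => by ring

/-- The zeros are eigenvalues of a truncated Jacobi matrix; evaluate the recurrence at the largest
entry of the eigenvector. -/
theorem abs_le_of_mem_zeroSet (h : IsAdmissible μ) {M : ℝ}
    (ha : ∀ n, |recA μ n| ≤ M) (hb : ∀ n, |recB μ n| ≤ M) {N : ℕ} {x : ℝ}
    (hx : x ∈ zeroSet μ N) : |x| ≤ 3 * M := by
  have hM : 0 ≤ M := (abs_nonneg _).trans (ha 0)
  have hN := pos_of_mem_zeroSet h hx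
  obtain ⟨i, hi, hmax⟩ := Finset.exists_max_image (Finset.range N)
    (fun i => |(orthoPoly μ i).eval x|) ⟨0, Finset.mem_range.2 hN⟩
  set y := |(orthoPoly μ i).eval x| with hy
  have hi := Finset.mem_range.1 hi
  have hy0 : 0 < y := by
    by_contra hle
    have hz : ∀ j ∈ Finset.range N, gaussWeight μ N x * (orthoPoly μ j).eval x ^ 2 = 0 := by
      intro j hj
      have : |(orthoPoly μ j).eval x| ≤ 0 := (hmax j hj).trans (not_lt.1 hle)
      rw [abs_nonpos_iff.1 this]; ring
    have := gaussWeight_mul_sum_sq h hx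
    rw [Finset.sum_eq_zero hz] at this
    exact zero_ne_one this
  have hle : ∀ j ≤ N, |(orthoPoly μ j).eval x| ≤ y := by
    intro j hj
    rcases hj.eq_or_lt with rfl | hj
    · rw [eval_eq_zero_of_mem_zeroSet hx, abs_zero]; exact hy0.le
    · exact hmax j (Finset.mem_range.2 hj)
  have hrec := congrArg (eval x) (three_term_recurrence h i)
  simp only [eval_mul, eval_add, eval_X, eval_C] at hrec
  have h3 : |eval x (if i = 0 then (0 : ℝ[X]) else orthoPoly μ (i - 1))| ≤ y := by
    split_ifs
    · simpa using hy0.le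
    · exact hle _ (by omega)
  have : |x| * y ≤ 3 * M * y := by
    rw [hy, ← abs_mul, hrec, ← hy]
    refine (abs_add_three _ _ _).trans ?_
    rw [abs_mul, abs_mul, abs_mul]
    calc _ ≤ M * y + M * y + M * y := by
          gcongr
          · exact hb _
          · exact hle _ hi
          · exact ha _
          · exact hb _
      _ = 3 * M * y := by ring
  exact le_of_mul_le_mul_right this hy0

/-- The power sums of the zeros of `p_N` agree with the partial traces of the powers of the Jacobi
operator up to an error that does not depend on `N`: by quadrature all but at most `m` of the
diagonal entries contribute exactly. -/
theorem abs_sum_pow_sub_sum_ip_le (h : IsAdmissible μ) {M : ℝ}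
    (ha : ∀ n, |recA μ n| ≤ M) (hb : ∀ n, |recB μ n| ≤ M) (N m : ℕ) :
    |∑ x ∈ zeroSet μ N, x ^ m
      - ∑ i ∈ Finset.range N, ip μ (X ^ m * orthoPoly μ i) (orthoPoly μ i)|
      ≤ m * (2 * (3 * M) ^ m) := by
  have hM : 0 ≤ M := (abs_nonneg _).trans (ha 0)
  have h1 : ∑ x ∈ zeroSet μ N, x ^ m = ∑ i ∈ Finset.range N,
      ∑ x ∈ zeroSet μ N, gaussWeight μ N x * (orthoPoly μ i).eval x ^ 2 * x ^ m := by
    rw [Finset.sum_comm]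
    refine Finset.sum_congr rfl fun x hx => ?_
    rw [← Finset.sum_mul, gaussWeight_mul_sum_sq h hx, one_mul]
  rw [h1, ← Finset.sum_sub_distrib]
  refine (Finset.abs_sum_le_sum_abs _ _).trans ?_
  have h2 : ∀ i ∈ Finset.range N,
      |∑ x ∈ zeroSet μ N, gaussWeight μ N x * (orthoPoly μ i).eval x ^ 2 * x ^ m
        - ip μ (X ^ m * orthoPoly μ i) (orthoPoly μ i)|
      ≤ if i + m < N then 0 else 2 * (3 * M) ^ m := by
    intro i hi
    have hi := Finset.mem_range.1 hi
    split_ifs with hm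
    · have := integral_eq_sum_gaussWeight h N (X ^ m * orthoPoly μ i * orthoPoly μ i) (by
        rw [degree_mul, degree_mul, degree_X_pow, degree_orthoPoly h]
        have : m + i + i < 2 * N := by omega
        exact_mod_cast this)
      simp only [eval_mul, eval_pow, eval_X] at this
      simp only [ip, eval_mul, eval_pow, eval_X]
      rw [this, ← Finset.sum_sub_distrib, Finset.sum_eq_zero fun x _ => by ring, abs_zero]
    · refine (abs_sub _ _).trans ?_
      rw [two_mul]
      refine add_le_add ?_ (abs_ip_X_pow_le h ha hb i m i)
      refine (Finset.abs_sum_le_sum_abs _ _).trans ?_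
      calc _ ≤ ∑ x ∈ zeroSet μ N,
            gaussWeight μ N x * (orthoPoly μ i).eval x ^ 2 * (3 * M) ^ m := by
            refine Finset.sum_le_sum fun x hx => ?_
            have hw := mul_nonneg (gaussWeight_nonneg h hx) (sq_nonneg ((orthoPoly μ i).eval x))
            rw [abs_mul, abs_of_nonneg hw, abs_pow]
            gcongr
            exact abs_le_of_mem_zeroSet h ha hb hx
        _ = (3 * M) ^ m := by
            rw [← Finset.sum_mul, sum_gaussWeight_mul_sq h hi, one_mul]
  refine (Finset.sum_le_sum h2).trans ?_
  rw [Finset.sum_ite, Finset.sum_const_zero, zero_add, Finset.sum_const, nsmul_eq_mul]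
  gcongr
  calc _ ≤ (Finset.Ico (N - m) N).card := Finset.card_le_card fun i hi => by
        simp only [Finset.mem_filter, Finset.mem_range, Finset.mem_Ico] at hi ⊢
        omega
    _ ≤ m := by rw [Nat.card_Ico]; omega

end Quadrature

/-! ### The support of the measures -/

/-- A bound for the recurrence coefficients bounds the support: the moments
`∫ x ^ (2m) dμ ≤ (3M) ^ (2m) μ(ℝ)` exclude mass beyond any radius larger than `3M`. -/
theorem ae_abs_lt_of_recurrence_bounded {μ : Measure ℝ} (h : IsAdmissible μ) {M : ℝ}
    (ha : ∀ n, |recA μ n| ≤ M) (hb : ∀ n, |recB μ n| ≤ M) :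
    ∀ᵐ x ∂μ, |x| < 3 * M + 1 := by
  have hM : 0 ≤ M := (abs_nonneg _).trans (ha 0)
  have := h.finite
  set c := (orthoPoly μ 0).coeff 0
  have hconst : orthoPoly μ 0 = C c := eq_C_of_natDegree_eq_zero (natDegree_orthoPoly h 0)
  have hc : 0 < c * c := mul_self_pos.2 fun e => orthoPoly_ne_zero h 0 (by rw [hconst, e, C_0])
  set t := μ.real {x | 3 * M + 1 ≤ |x|} with ht
  have hmom : ∀ m : ℕ, t * ((3 * M + 1) ^ 2) ^ m * (c * c) ≤ ((3 * M) ^ 2) ^ m := by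
    intro m
    have h1 := mul_meas_ge_le_integral_of_nonneg (μ := μ) (f := fun x : ℝ => x ^ (2 * m))
      (ae_of_all _ fun x => by simp only [Pi.zero_apply]; rw [pow_mul]; positivity)
      (h.integrable (continuous_pow _)) ((3 * M + 1) ^ (2 * m))
    have h2 : t ≤ μ.real {x : ℝ | (3 * M + 1) ^ (2 * m) ≤ x ^ (2 * m)} := by
      refine measureReal_mono fun x hx => ?_
      have := pow_le_pow_left₀ (by positivity) (Set.mem_ofPred.1 hx) (2 * m)
      rwa [(even_two_mul m).pow_abs] at this
    have h3 := (le_abs_self _).trans (abs_ip_X_pow_le h ha hb 0 (2 * m) 0)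
    have h4 : ip μ (X ^ (2 * m) * orthoPoly μ 0) (orthoPoly μ 0)
        = (∫ x, x ^ (2 * m) ∂μ) * (c * c) := by
      rw [hconst, ip, ← integral_mul_const]
      congr 1; ext x; simp; ring
    rw [h4] at h3
    rw [← pow_mul, ← pow_mul]
    refine le_trans ?_ h3
    gcongr
    rw [mul_comm]
    exact le_trans (by gcongr) h1
  have ht0 : t = 0 := by
    by_contra hne
    have htpos : 0 < t * (c * c) := mul_pos (lt_of_le_of_ne measureReal_nonneg (Ne.symm hne)) hc
    set ρ := (3 * M) ^ 2 / (3 * M + 1) ^ 2 with hρ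
    have hρ1 : ρ < 1 := by
      rw [hρ, div_lt_one (by positivity)]
      gcongr; linarith
    obtain ⟨m, hm⟩ := exists_pow_lt_of_lt_one htpos hρ1
    rw [hρ, div_pow, div_lt_iff₀ (by positivity)] at hm
    linarith [hmom m]
  rw [ae_iff]
  have : {x : ℝ | ¬ |x| < 3 * M + 1} = {x | 3 * M + 1 ≤ |x|} := by ext x; simp
  rw [this]
  exact (measureReal_eq_zero_iff (measure_ne_top _ _)).1 ht0

/-! ### The moments of the mean zero distributions -/

theorem sum_range_sub_eq_sum_antidiagonals (F : ℕ → ℕ → ℝ) (n : ℕ) :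
    ∑ k ∈ Finset.range (n + 1), ∑ i ∈ Finset.range (k + 1), F (n - k) i
      = ∑ N ∈ Finset.range (n + 1), ∑ i ∈ Finset.range (N + 1), F (N - i) i := by
  rw [Finset.sum_sigma', Finset.sum_sigma']
  refine Finset.sum_bij' (fun p _ => ⟨n - p.1 + p.2, p.2⟩) (fun p _ => ⟨n - p.1 + p.2, p.2⟩)
    ?_ ?_ ?_ ?_ ?_
  · rintro ⟨k, i⟩ hp
    simp only [Finset.mem_sigma, Finset.mem_range] at hp ⊢
    omega
  · rintro ⟨k, i⟩ hp
    simp only [Finset.mem_sigma, Finset.mem_range] at hp ⊢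
    omega
  · rintro ⟨k, i⟩ hp
    simp only [Finset.mem_sigma, Finset.mem_range] at hp
    have : n - (n - k + i) + i = k := by omega
    simp [this]
  · rintro ⟨k, i⟩ hp
    simp only [Finset.mem_sigma, Finset.mem_range] at hp
    have : n - (n - k + i) + i = k := by omega
    simp [this]
  · rintro ⟨k, i⟩ hp
    congr 1
    simp

theorem sum_range_add_one (n : ℕ) :
    ∑ N ∈ Finset.range (n + 1), ((N : ℝ) + 1) = ((n : ℝ) + 1) * (n + 2) / 2 := by
  induction n with
  | zero => norm_num
  | succ n ih => rw [Finset.sum_range_succ, ih]; push_cast; ring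

/-- The means with weights proportional to `N + 1` preserve limits. -/
theorem tendsto_linear_weighted_mean {u : ℕ → ℝ} {L : ℝ} (h : Tendsto u atTop (𝓝 L)) :
    Tendsto (fun n : ℕ => 2 / (((n : ℝ) + 1) * ((n : ℝ) + 2)) *
      ∑ N ∈ Finset.range (n + 1), ((N : ℝ) + 1) * u N) atTop (𝓝 L) := by
  have h0 : Tendsto (fun n => |u n - L|) atTop (𝓝 0) := by
    simpa using (h.sub_const L).abs
  have h1 := (((tendsto_add_atTop_iff_nat 1).2 h0.cesaro)).const_mul 2
  rw [mul_zero] at h1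
  rw [← tendsto_sub_nhds_zero_iff]
  refine squeeze_zero_norm (fun n => ?_) h1
  have e : 2 / (((n : ℝ) + 1) * ((n : ℝ) + 2)) *
      ∑ N ∈ Finset.range (n + 1), ((N : ℝ) + 1) * u N - L
      = 2 / (((n : ℝ) + 1) * ((n : ℝ) + 2)) *
        ∑ N ∈ Finset.range (n + 1), ((N : ℝ) + 1) * (u N - L) := by
    simp only [mul_sub, Finset.sum_sub_distrib, ← Finset.sum_mul, sum_range_add_one]
    field_simp
  rw [e, norm_mul, Real.norm_of_nonneg (by positivity)]
  calc _ ≤ 2 / (((n : ℝ) + 1) * ((n : ℝ) + 2)) *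
        ∑ N ∈ Finset.range (n + 1), ((n : ℝ) + 2) * |u N - L| := by
        gcongr
        refine (norm_sum_le _ _).trans (Finset.sum_le_sum fun N hN => ?_)
        have : (N : ℝ) + 1 ≤ n + 2 := by
          have := Finset.mem_range.1 hN
          exact_mod_cast (by omega : N + 1 ≤ n + 2)
        rw [norm_mul, Real.norm_of_nonneg (by positivity), Real.norm_eq_abs]
        gcongr
    _ = 2 * (((n + 1 : ℕ) : ℝ)⁻¹ * ∑ N ∈ Finset.range (n + 1), |u N - L|) := by
        rw [← Finset.mul_sum]
        push_cast
        field_simp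

/-- Convergence of the moments of the mean zero distributions. By the comparison of power sums and
traces these are linearly weighted means of the moments of the mean measures. -/
theorem tendsto_mean_sum_zeroSet_pow {μ : ℕ → Measure ℝ} (hμ : ∀ k, IsAdmissible (μ k))
    (hc : MeanNevaiClass arithmeticMean legendreSigma μ) (m : ℕ) :
    Tendsto (fun n : ℕ => 2 / (((n : ℝ) + 1) * ((n : ℝ) + 2)) *
      ∑ k ∈ Finset.range (n + 1), ∑ x ∈ zeroSet (μ (n - k)) (k + 1), x ^ m)
      atTop (𝓝 (1 / 2 * ∫ x in (-1 : ℝ)..1, x ^ m)) := by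
  obtain ⟨M, hM1, hA, hB⟩ := hc.exists_bound
  set d : ℕ → ℕ → ℝ := fun s k => ip (μ s) (X ^ m * orthoPoly (μ s) k) (orthoPoly (μ s) k)
    with hd
  have hmain := tendsto_linear_weighted_mean (tendsto_diagMean_ip_X_pow hμ hc m)
  have hre : ∀ n : ℕ, ∑ N ∈ Finset.range (n + 1), ((N : ℝ) + 1) * diagMean d N
      = ∑ k ∈ Finset.range (n + 1), ∑ i ∈ Finset.range (k + 1), d (n - k) i := by
    intro n
    rw [sum_range_sub_eq_sum_antidiagonals]
    refine Finset.sum_congr rfl fun N _ => ?_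
    rw [diagMean, Finset.mul_sum]
    refine Finset.sum_congr rfl fun i _ => ?_
    field_simp
  set K : ℝ := m * (2 * (3 * M) ^ m) with hK
  have hK0 : 0 ≤ K := by positivity
  have herr : Tendsto (fun n : ℕ => 2 / (((n : ℝ) + 1) * ((n : ℝ) + 2)) *
      ∑ k ∈ Finset.range (n + 1), (∑ x ∈ zeroSet (μ (n - k)) (k + 1), x ^ m
        - ∑ i ∈ Finset.range (k + 1), d (n - k) i)) atTop (𝓝 0) := by
    have hz := (tendsto_one_div_add_atTop_nhds_zero_nat (𝕜 := ℝ)).const_mul (2 * K)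
    rw [mul_zero] at hz
    refine squeeze_zero_norm (fun n => ?_) hz
    rw [norm_mul, Real.norm_of_nonneg (by positivity)]
    calc _ ≤ 2 / (((n : ℝ) + 1) * ((n : ℝ) + 2)) * ∑ k ∈ Finset.range (n + 1), K := by
          gcongr
          refine (norm_sum_le _ _).trans (Finset.sum_le_sum fun k _ => ?_)
          exact abs_sum_pow_sub_sum_ip_le (hμ _) (hA _) (hB _) (k + 1) m
      _ = 2 * K * (1 / ((n : ℝ) + 2)) := by
          rw [Finset.sum_const, Finset.card_range, nsmul_eq_mul]
          push_cast
          field_simp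
      _ ≤ _ := by gcongr; norm_num
  have := herr.add hmain
  rw [zero_add] at this
  refine this.congr fun n => ?_
  rw [hre, Finset.sum_sub_distrib]
  ring

/-! ### From moments to weak convergence -/

section Weak

instance isProbabilityMeasure_uniformMeasure : IsProbabilityMeasure uniformMeasure := by
  constructor
  rw [uniformMeasure, Measure.smul_apply, Measure.restrict_apply_univ, Real.volume_Icc]
  norm_num
  exact ENNReal.inv_mul_cancel (by norm_num) (by norm_num)

theorem integral_uniformMeasure (f : ℝ → ℝ) :
    ∫ x, f x ∂uniformMeasure = 1 / 2 * ∫ x in (-1 : ℝ)..1, f x := by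
  rw [uniformMeasure, integral_smul_measure, integral_Icc_eq_integral_Ioc,
    ← intervalIntegral.integral_of_le (by norm_num)]
  simp

theorem ae_uniformMeasure_mem_Icc : ∀ᵐ x ∂uniformMeasure, x ∈ Set.Icc (-1 : ℝ) 1 := by
  rw [uniformMeasure]
  exact Measure.ae_smul_measure (ae_restrict_mem measurableSet_Icc) _

theorem integrable_of_ae_mem_Icc {P : Measure ℝ} [IsFiniteMeasure P] {a b : ℝ}
    (hs : ∀ᵐ x ∂P, x ∈ Set.Icc a b) {f : ℝ → ℝ} (hf : Continuous f) : Integrable f P := by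
  have h1 : IntegrableOn f (Set.Icc a b) P := hf.continuousOn.integrableOn_compact isCompact_Icc
  rwa [IntegrableOn, Measure.restrict_eq_self_of_ae_mem hs] at h1

variable {m : ℕ → Measure ℝ} [∀ n, IsProbabilityMeasure (m n)]

/-- Moment convergence implies convergence of the integrals of continuous functions if the
supports are uniformly bounded, by the Weierstrass approximation theorem. -/
theorem tendsto_integral_of_tendsto_moments {P : Measure ℝ} [IsProbabilityMeasure P] {a b : ℝ}
    (hs : ∀ n, ∀ᵐ x ∂(m n), x ∈ Set.Icc a b) (hP : ∀ᵐ x ∂P, x ∈ Set.Icc a b)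
    (hm : ∀ j : ℕ, Tendsto (fun n => ∫ x, x ^ j ∂(m n)) atTop (𝓝 (∫ x, x ^ j ∂P)))
    {f : ℝ → ℝ} (hf : Continuous f) :
    Tendsto (fun n => ∫ x, f x ∂(m n)) atTop (𝓝 (∫ x, f x ∂P)) := by
  have hpoly : ∀ p : ℝ[X], Tendsto (fun n => ∫ x, p.eval x ∂(m n)) atTop
      (𝓝 (∫ x, p.eval x ∂P)) := by
    intro p
    have e : ∀ (Q : Measure ℝ) [IsProbabilityMeasure Q], (∀ᵐ x ∂Q, x ∈ Set.Icc a b) →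
        ∫ x, p.eval x ∂Q = ∑ j ∈ Finset.range (p.natDegree + 1), p.coeff j * ∫ x, x ^ j ∂Q := by
      intro Q _ hQ
      simp only [eval_eq_sum_range]
      rw [integral_finsetSum _ fun j _ =>
        (integrable_of_ae_mem_Icc hQ (continuous_pow j)).const_mul _]
      simp only [integral_const_mul]
    rw [e P hP]
    simp_rw [fun n => e (m n) (hs n)]
    exact tendsto_finsetSum _ fun j _ => (hm j).const_mul _
  rw [Metric.tendsto_nhds]
  intro ε hε
  obtain ⟨p, hp⟩ := exists_polynomial_near_of_continuousOn a b f hf.continuousOn (ε / 3)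
    (by positivity)
  have hclose : ∀ (Q : Measure ℝ) [IsProbabilityMeasure Q], (∀ᵐ x ∂Q, x ∈ Set.Icc a b) →
      |∫ x, p.eval x ∂Q - ∫ x, f x ∂Q| ≤ ε / 3 := by
    intro Q _ hQ
    rw [← integral_sub (integrable_of_ae_mem_Icc hQ p.continuous)
      (integrable_of_ae_mem_Icc hQ hf)]
    have := norm_integral_le_of_norm_le_const (μ := Q) (f := fun x => p.eval x - f x)
      (C := ε / 3) (by
        filter_upwards [hQ] with x hx using (hp x hx).le)
    simpa using this
  filter_upwards [Metric.tendsto_nhds.1 (hpoly p) (ε / 3) (by positivity)] with n hn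
  have h1 := abs_le.1 (hclose (m n) (hs n))
  have h2 := abs_le.1 (hclose P hP)
  rw [Real.dist_eq, abs_lt] at hn ⊢
  constructor <;> linarith

theorem convergesWeakly_of_tendsto_integral {P : Measure ℝ} [hP : IsProbabilityMeasure P]
    (h : ∀ f : ℝ → ℝ, Continuous f → Tendsto (fun n => ∫ x, f x ∂(m n)) atTop (𝓝 (∫ x, f x ∂P))) :
    ConvergesWeakly m P := by
  refine ⟨inferInstance, hP, ?_⟩
  exact ProbabilityMeasure.tendsto_iff_forall_integral_tendsto.2 fun f => h f f.continuous

/-- A function that is continuous on `[-1, 1]` is extended by constants. The part of the extension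
outside `[-1, 1]` does not contribute in the limit, as the end points carry no mass. -/
theorem tendsto_setIntegral_Icc
    (h : ∀ f : ℝ → ℝ, Continuous f →
      Tendsto (fun n => ∫ x, f x ∂(m n)) atTop (𝓝 (∫ x, f x ∂uniformMeasure)))
    {f : ℝ → ℝ} (hf : ContinuousOn f (Set.Icc (-1) 1)) :
    Tendsto (fun n => ∫ x in Set.Icc (-1) 1, f x ∂(m n)) atTop
      (𝓝 (1 / 2 * ∫ x in (-1 : ℝ)..1, f x)) := by
  have hle : (-1 : ℝ) ≤ 1 := by norm_num
  set g : ℝ → ℝ := Set.IccExtend hle (Set.domRestrict (Set.Icc (-1) 1) f) with hg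
  have hgc : Continuous g := hf.domRestrict.Icc_extend'
  have hgf : ∀ x ∈ Set.Icc (-1 : ℝ) 1, g x = f x := fun x hx => Set.IccExtend_of_mem hle _ hx
  obtain ⟨B, hB⟩ := isCompact_Icc.exists_bound_of_continuousOn hf
  have hgB : ∀ x, ‖g x‖ ≤ B := fun x => hB _ (Set.projIcc (-1) 1 hle x).2
  obtain ⟨h1, h2, hw⟩ := convergesWeakly_of_tendsto_integral h
  have hfr : uniformMeasure (frontier (Set.Icc (-1 : ℝ) 1)) = 0 := by
    rw [frontier_Icc hle, uniformMeasure, Measure.smul_apply]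
    have : volume.restrict (Set.Icc (-1 : ℝ) 1) {-1, 1} = 0 :=
      (Set.toFinite _).measure_zero _
    rw [this, smul_zero]
  have hmass : Tendsto (fun n => m n (Set.Icc (-1 : ℝ) 1)) atTop
      (𝓝 (uniformMeasure (Set.Icc (-1 : ℝ) 1))) :=
    ProbabilityMeasure.tendsto_measure_of_null_frontier_of_tendsto' hw hfr
  have hU : uniformMeasure (Set.Icc (-1 : ℝ) 1) = 1 :=
    (prob_compl_eq_zero_iff measurableSet_Icc).1 ae_uniformMeasure_mem_Icc
  have hout : Tendsto (fun n => (m n).real (Set.Icc (-1 : ℝ) 1)ᶜ) atTop (𝓝 0) := by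
    have h3 := (ENNReal.tendsto_toReal (measure_ne_top _ _)).comp hmass
    have h4 := h3.const_sub 1
    simp only [hU, ENNReal.toReal_one, sub_self] at h4
    refine h4.congr fun n => ?_
    rw [probReal_compl_eq_one_sub measurableSet_Icc]; rfl
  have hrem : Tendsto (fun n => ∫ x in (Set.Icc (-1 : ℝ) 1)ᶜ, g x ∂(m n)) atTop (𝓝 0) := by
    have := hout.const_mul B
    rw [mul_zero] at this
    exact squeeze_zero_norm (fun n => norm_setIntegral_le_of_norm_le_const (measure_lt_top _ _)
      fun x _ => hgB x) this
  have hlim := (h g hgc).sub hrem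
  have hval : ∫ x, g x ∂uniformMeasure = 1 / 2 * ∫ x in (-1 : ℝ)..1, f x := by
    rw [integral_uniformMeasure]
    congr 1
    refine intervalIntegral.integral_congr fun x hx => hgf x ?_
    rwa [Set.uIcc_of_le hle] at hx
  rw [hval, sub_zero] at hlim
  refine hlim.congr fun n => ?_
  have hgi : Integrable g (m n) :=
    Integrable.of_bound hgc.aestronglyMeasurable B (ae_of_all _ hgB)
  rw [← setIntegral_congr_fun measurableSet_Icc hgf, sub_eq_iff_eq_add,
    integral_add_compl measurableSet_Icc hgi]

end Weak

/-! ### Integrals with respect to the mean measures and the mean zero distributions -/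

section Integrals

variable {μ : ℕ → Measure ℝ}

theorem integral_meanMeasure {f : ℝ → ℝ}
    (hf : ∀ s k, Integrable (fun x => f x * (orthoPoly (μ s) k).eval x ^ 2) (μ s)) (n : ℕ) :
    ∫ x, f x ∂(meanMeasure arithmeticMean μ n) =
      ∑ k ∈ Finset.range (n + 1), 1 / ((n : ℝ) + 1) *
        ∫ x, f x * (orthoPoly (μ (n - k)) k).eval x ^ 2 ∂(μ (n - k)) := by
  have hmeas : ∀ s k, Measurable fun x => ENNReal.ofReal ((orthoPoly (μ s) k).eval x ^ 2) :=
    fun s k => ((orthoPoly (μ s) k).continuous.pow 2).measurable.ennreal_ofReal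
  have hmul : ∀ s k, (fun x => (ENNReal.ofReal ((orthoPoly (μ s) k).eval x ^ 2)).toReal • f x)
      = fun x => f x * (orthoPoly (μ s) k).eval x ^ 2 := by
    intro s k
    ext x
    rw [ENNReal.toReal_ofReal (sq_nonneg _), smul_eq_mul, mul_comm]
  have hint : ∀ s k, Integrable f ((μ s).withDensity
      fun x => ENNReal.ofReal ((orthoPoly (μ s) k).eval x ^ 2)) := by
    intro s k
    rw [integrable_withDensity_iff_integrable_smul' (hmeas s k)
      (ae_of_all _ fun _ => ENNReal.ofReal_lt_top), hmul]
    exact hf s k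
  rw [meanMeasure, integral_finsetSum_measure fun k _ =>
    (hint _ _).smul_measure ENNReal.ofReal_ne_top]
  refine Finset.sum_congr rfl fun k hk => ?_
  rw [integral_smul_measure, integral_withDensity_eq_integral_toReal_smul (hmeas _ _)
    (ae_of_all _ fun _ => ENNReal.ofReal_lt_top), hmul,
    ENNReal.toReal_ofReal (arithmeticMean.nonneg n k (by have := Finset.mem_range.1 hk; omega)),
    smul_eq_mul]
  rfl

theorem integral_meanMeasure_of_continuous (hμ : ∀ k, IsAdmissible (μ k)) {f : ℝ → ℝ}
    (hf : Continuous f) (n : ℕ) :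
    ∫ x, f x ∂(meanMeasure arithmeticMean μ n) =
      ∑ k ∈ Finset.range (n + 1), 1 / ((n : ℝ) + 1) *
        ∫ x, f x * (orthoPoly (μ (n - k)) k).eval x ^ 2 ∂(μ (n - k)) :=
  integral_meanMeasure
    (fun s k => (hμ s).integrable (hf.mul ((orthoPoly (μ s) k).continuous.pow 2))) n

theorem setIntegral_meanMeasure {f : ℝ → ℝ}
    {a b : ℝ} (hμ : ∀ k, IsAdmissible (μ k)) (hf : ContinuousOn f (Set.Icc a b)) (n : ℕ) :
    ∫ x in Set.Icc a b, f x ∂(meanMeasure arithmeticMean μ n) =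
      ∑ k ∈ Finset.range (n + 1), 1 / ((n : ℝ) + 1) *
        ∫ x in Set.Icc a b, f x * (orthoPoly (μ (n - k)) k).eval x ^ 2 ∂(μ (n - k)) := by
  have hind : ∀ s k, (fun x => (Set.Icc a b).indicator f x * (orthoPoly (μ s) k).eval x ^ 2)
      = (Set.Icc a b).indicator fun x => f x * (orthoPoly (μ s) k).eval x ^ 2 := by
    intro s k
    ext x
    by_cases hx : x ∈ Set.Icc a b <;> simp [hx]
  rw [← integral_indicator measurableSet_Icc, integral_meanMeasure]
  · refine Finset.sum_congr rfl fun k _ => ?_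
    rw [hind, integral_indicator measurableSet_Icc]
  · intro s k
    have := (hμ s).finite
    rw [hind, integrable_indicator_iff measurableSet_Icc]
    exact (hf.mul ((orthoPoly (μ s) k).continuous.pow 2).continuousOn).integrableOn_compact
      isCompact_Icc

theorem isProbabilityMeasure_meanMeasure (hμ : ∀ k, IsAdmissible (μ k)) (n : ℕ) :
    IsProbabilityMeasure (meanMeasure arithmeticMean μ n) := by
  constructor
  have hmass : ∀ s k, (μ s).withDensity
      (fun x => ENNReal.ofReal ((orthoPoly (μ s) k).eval x ^ 2)) Set.univ = 1 := by
    intro s k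
    have h1 := ip_orthoPoly (hμ s) k k
    rw [if_pos rfl, ip] at h1
    have h2 := ofReal_integral_eq_lintegral_ofReal
      ((hμ s).integrable_mul (orthoPoly (μ s) k) (orthoPoly (μ s) k))
      (ae_of_all _ fun x => mul_self_nonneg _)
    rw [h1, ENNReal.ofReal_one] at h2
    rw [withDensity_apply _ MeasurableSet.univ, setLIntegral_univ, h2]
    simp only [sq]
  rw [meanMeasure, Measure.finsetSum_apply]
  simp only [Measure.smul_apply, hmass, smul_eq_mul, mul_one]
  rw [← ENNReal.ofReal_sum_of_nonneg fun k hk =>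
    arithmeticMean.nonneg n k (by have := Finset.mem_range.1 hk; omega),
    arithmeticMean.sum_eq_one, ENNReal.ofReal_one]

theorem ae_meanMeasure {p : ℝ → Prop} (h : ∀ k, ∀ᵐ x ∂(μ k), p x) (n : ℕ) :
    ∀ᵐ x ∂(meanMeasure arithmeticMean μ n), p x := by
  rw [meanMeasure, ae_iff, Measure.finsetSum_apply]
  refine Finset.sum_eq_zero fun k _ => ?_
  rw [Measure.smul_apply, smul_eq_mul,
    withDensity_absolutelyContinuous (μ (n - k)) _ (ae_iff.1 (h (n - k))), mul_zero]

theorem zeroMeasure_eq (hμ : ∀ k, IsAdmissible (μ k)) (n : ℕ) :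
    zeroMeasure μ n = ENNReal.ofReal (2 / (((n : ℝ) + 1) * ((n : ℝ) + 2))) •
      ∑ k ∈ Finset.range (n + 1), ∑ x ∈ zeroSet (μ (n - k)) (k + 1), Measure.dirac x := by
  rw [zeroMeasure]
  congr 1
  refine Finset.sum_congr rfl fun k _ => ?_
  rw [zeroSet, Finset.sum, Multiset.toFinset_val, (nodup_roots_orthoPoly (hμ _) _).dedup]

theorem integral_zeroMeasure (hμ : ∀ k, IsAdmissible (μ k)) (f : ℝ → ℝ) (n : ℕ) :
    ∫ x, f x ∂(zeroMeasure μ n) = 2 / (((n : ℝ) + 1) * ((n : ℝ) + 2)) *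
      ∑ k ∈ Finset.range (n + 1), ∑ x ∈ zeroSet (μ (n - k)) (k + 1), f x := by
  have hd : ∀ x : ℝ, Integrable f (Measure.dirac x) := fun x => integrable_dirac (by simp)
  rw [zeroMeasure_eq hμ, integral_smul_measure, ENNReal.toReal_ofReal (by positivity),
    smul_eq_mul, integral_finsetSum_measure fun k _ =>
      integrable_finsetSum_measure.2 fun x _ => hd x]
  congr 1
  refine Finset.sum_congr rfl fun k _ => ?_
  rw [integral_finsetSum_measure fun x _ => hd x]
  exact Finset.sum_congr rfl fun x _ => integral_dirac f x

theorem isProbabilityMeasure_zeroMeasure (hμ : ∀ k, IsAdmissible (μ k)) (n : ℕ) :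
    IsProbabilityMeasure (zeroMeasure μ n) := by
  constructor
  rw [zeroMeasure_eq hμ, Measure.smul_apply, Measure.finsetSum_apply]
  simp only [Measure.finsetSum_apply, measure_univ, Finset.sum_const, card_zeroSet (hμ _)]
  have : ∑ k ∈ Finset.range (n + 1), (k + 1) • (1 : ℝ≥0∞)
      = ENNReal.ofReal (((n : ℝ) + 1) * (n + 2) / 2) := by
    rw [← sum_range_add_one, ENNReal.ofReal_sum_of_nonneg fun _ _ => by positivity]
    refine Finset.sum_congr rfl fun k _ => ?_
    rw [nsmul_eq_mul, mul_one, ← ENNReal.ofReal_natCast]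
    push_cast; rfl
  rw [this, smul_eq_mul, ← ENNReal.ofReal_mul (by positivity), ← ENNReal.ofReal_one]
  congr 1
  field_simp

theorem ae_zeroMeasure (hμ : ∀ k, IsAdmissible (μ k)) {p : ℝ → Prop}
    (h : ∀ s k, ∀ x ∈ zeroSet (μ s) k, p x) (n : ℕ) : ∀ᵐ x ∂(zeroMeasure μ n), p x := by
  rw [zeroMeasure_eq hμ, ae_iff, Measure.smul_apply, Measure.finsetSum_apply]
  rw [Finset.sum_eq_zero fun k _ => ?_, smul_zero]
  rw [Measure.finsetSum_apply]
  refine Finset.sum_eq_zero fun x hx => ?_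
  rw [Measure.dirac_apply, Set.indicator_of_notMem]
  exact fun hn => hn (h _ _ x hx)

end Integrals

end MeanNevai

theorem mainTheorem6 (μ : ℕ → Measure ℝ) (hμ : ∀ k, MeanNevai.IsAdmissible (μ k))
    (hclass : MeanNevai.MeanNevaiClass MeanNevai.arithmeticMean MeanNevai.legendreSigma μ) :
    -- the equilibrium measure is the uniform probability measure on `[-1, 1]`
    MeanNevai.IsEquilibriumMeasure MeanNevai.arithmeticMean μ MeanNevai.uniformMeasure ∧
    -- the mean zero distributions have the same weak limit
    MeanNevai.ConvergesWeakly (MeanNevai.zeroMeasure μ) MeanNevai.uniformMeasure ∧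
    -- the limits for test functions that are continuous on the line
    (∀ f : ℝ → ℝ, Continuous f →
      Tendsto (fun n : ℕ => ∑ k ∈ Finset.range (n + 1), 1 / ((n : ℝ) + 1) *
          ∫ x, f x * (MeanNevai.orthoPoly (μ (n - k)) k).eval x ^ 2 ∂(μ (n - k)))
        atTop (𝓝 (1 / 2 * ∫ x in (-1 : ℝ)..1, f x)) ∧
      Tendsto (fun n : ℕ => ∑ k ∈ Finset.range (n + 1),
          ((MeanNevai.orthoPoly (μ (n - k)) (k + 1)).roots.map
            (fun x => 2 * f x / (((n : ℝ) + 1) * ((n : ℝ) + 2)))).sum)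
        atTop (𝓝 (1 / 2 * ∫ x in (-1 : ℝ)..1, f x))) ∧
    -- the limits for test functions that are given on `[-1, 1]` only
    (∀ f : ℝ → ℝ, ContinuousOn f (Set.Icc (-1) 1) →
      Tendsto (fun n : ℕ => ∑ k ∈ Finset.range (n + 1), 1 / ((n : ℝ) + 1) *
          ∫ x in Set.Icc (-1 : ℝ) 1,
            f x * (MeanNevai.orthoPoly (μ (n - k)) k).eval x ^ 2 ∂(μ (n - k)))
        atTop (𝓝 (1 / 2 * ∫ x in (-1 : ℝ)..1, f x)) ∧
      Tendsto (fun n : ℕ => ∑ k ∈ Finset.range (n + 1),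
          ((MeanNevai.orthoPoly (μ (n - k)) (k + 1)).roots.map
            ((Set.Icc (-1 : ℝ) 1).indicator
              (fun x => 2 * f x / (((n : ℝ) + 1) * ((n : ℝ) + 2))))).sum)
        atTop (𝓝 (1 / 2 * ∫ x in (-1 : ℝ)..1, f x))) := by
  open MeanNevai in
  obtain ⟨M, hM, hA, hB⟩ := hclass.exists_bound
  have hmean := isProbabilityMeasure_meanMeasure hμ
  have hzero := isProbabilityMeasure_zeroMeasure hμ
  have hsm : ∀ n, ∀ᵐ x ∂(meanMeasure arithmeticMean μ n),
      x ∈ Set.Icc (-(3 * M + 1)) (3 * M + 1) :=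
    ae_meanMeasure fun k => (ae_abs_lt_of_recurrence_bounded (hμ k) (hA k) (hB k)).mono
      fun x hx => abs_le.1 hx.le
  have hsz : ∀ n, ∀ᵐ x ∂(zeroMeasure μ n), x ∈ Set.Icc (-(3 * M + 1)) (3 * M + 1) :=
    ae_zeroMeasure hμ fun s k x hx => abs_le.1 <|
      (abs_le_of_mem_zeroSet (hμ s) (hA s) (hB s) hx).trans (by linarith)
  have hsu : ∀ᵐ x ∂uniformMeasure, x ∈ Set.Icc (-(3 * M + 1)) (3 * M + 1) :=
    ae_uniformMeasure_mem_Icc.mono fun x hx => ⟨by linarith [hx.1], by linarith [hx.2]⟩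
  have hm : ∀ f : ℝ → ℝ, Continuous f →
      Tendsto (fun n => ∫ x, f x ∂(meanMeasure arithmeticMean μ n)) atTop
        (𝓝 (∫ x, f x ∂uniformMeasure)) := by
    refine fun f hf => tendsto_integral_of_tendsto_moments hsm hsu (fun j => ?_) hf
    rw [integral_uniformMeasure]
    refine (tendsto_diagMean_ip_X_pow hμ hclass j).congr fun n => ?_
    rw [integral_meanMeasure_of_continuous hμ (continuous_pow j)]
    refine Finset.sum_congr rfl fun k _ => ?_
    simp only [ip, eval_mul, eval_pow, eval_X, mul_assoc, sq]
  have hz : ∀ f : ℝ → ℝ, Continuous f →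
      Tendsto (fun n => ∫ x, f x ∂(zeroMeasure μ n)) atTop (𝓝 (∫ x, f x ∂uniformMeasure)) := by
    refine fun f hf => tendsto_integral_of_tendsto_moments hsz hsu (fun j => ?_) hf
    rw [integral_uniformMeasure]
    refine (tendsto_mean_sum_zeroSet_pow hμ hclass j).congr fun n => ?_
    rw [integral_zeroMeasure hμ]
  have hroots : ∀ (f : ℝ → ℝ) (n : ℕ), ∫ x, f x ∂(zeroMeasure μ n) =
      ∑ k ∈ Finset.range (n + 1), ((orthoPoly (μ (n - k)) (k + 1)).roots.map
        (fun x => 2 * f x / (((n : ℝ) + 1) * ((n : ℝ) + 2)))).sum := by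
    intro f n
    rw [integral_zeroMeasure hμ, Finset.mul_sum]
    refine Finset.sum_congr rfl fun k _ => ?_
    rw [sum_roots_map_eq (hμ _), Finset.mul_sum]
    exact Finset.sum_congr rfl fun x _ => by ring
  refine ⟨convergesWeakly_of_tendsto_integral hm, convergesWeakly_of_tendsto_integral hz,
    fun f hf => ⟨?_, ?_⟩, fun f hf => ⟨?_, ?_⟩⟩
  · rw [← integral_uniformMeasure]
    exact (hm f hf).congr fun n => integral_meanMeasure_of_continuous hμ hf n
  · rw [← integral_uniformMeasure]
    exact (hz f hf).congr fun n => hroots f n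
  · exact (tendsto_setIntegral_Icc hm hf).congr fun n => setIntegral_meanMeasure hμ hf n
  · refine (tendsto_setIntegral_Icc hz hf).congr fun n => ?_
    rw [← integral_indicator measurableSet_Icc, hroots]
    refine Finset.sum_congr rfl fun k _ => ?_
    congr 2
    ext x
    by_cases hx : x ∈ Set.Icc (-1 : ℝ) 1 <;> simp [hx]
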